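/- **Setting.** Let $Q=[-1,1]^2$, and let $\varphi_k(t)=\sqrt{k+1/2}\,(2^kk!)^{-1}\frac{d^k}{dt^k}(t^2-1)^k$, $k=0,1,2,\dots$, be the orthonormal Legendre polynomials on $[-1,1]$. For real $f\in L_2=L_2(Q)$ let $\langle f,\varphi_{k,j}\rangle=\int_Q f(t,\tau)\varphi_k(t)\varphi_j(\tau)\,d\tau\,dt$. For $1\le s<\infty$ and $\overline\mu=(\mu_1,\mu_2)$ let $$\|f\|_{s,\overline\mu}=\Big(\sum_{k,j\ge 0}\max(1,k)^{s\mu_1}\max(1,j)^{s\mu_2}|\langle f,\varphi_{k,j}\rangle|^s\Big)^{1/s},\qquad L^{\overline\mu}_{s,2}=\{f\in L_2:\ \|f\|_{s,\overline\mu}\le 1\}.$$ For an integer $r\ge1$, the derivative $f^{(r,0)}$ is the $L_2$-sum of the series $\sum_{k\ge r}\sum_{j\ge0}\langle f,\varphi_{k,j}\rangle\varphi_k^{(r)}(t)\varphi_j(\tau)$. For $1\le p\le\infty$ and $0<\delta<1$, a real sequence $\overline{f}^\delta=\{y_{k,j}\}_{k,j\ge 0}$ is admissible for $f$ if the sequence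 $\{\langle f,\varphi_{k,j}\rangle-y_{k,j}\}$ has $\ell_p$-norm at most $\delta$. For a finite set $\Omega$ of integer points of $[r,\infty)\times[0,\infty)$, an algorithm on $\Omega$ is an arbitrary map $\psi:\mathbb R^\Omega\to L_2$, with error $$\varepsilon_\delta(\psi)=\sup_{f\in L^{\overline\mu}_{s,2}}\ \sup_{\overline f^\delta\text{ admissible for }f}\big\|f^{(r,0)}-\psi\big((y_{k,j})_{(k,j)\in\Omega}\big)\big\|_{L_2}.$$ The minimal radius of Galerkin information is $R_{N,\delta}=R^{(r,0)}_{N,\delta}(L^{\overline\mu}_{s,2},L_2,\ell_p)=\inf_{\operatorname{card}\Omega\le N}\inf_{\psi}\varepsilon_\delta(\psi)$. For an integer $n\ge0$ and $\gamma\ge1$ let $\Gamma_{n,\gamma}=\{(k,j):\ kj^\gamma\le n,\ r\le k\le n,\ 0\le j\le (n/r)^{1/\gamma}\}$; the truncation method $\mathcal D_{n,\gamma}$ is the algorithm on $\Gamma_{n,\gamma}$ with $\mathcal D_{n,\gamma}(y)=\sum_{(k,j)\in\Gamma_{n,\gamma}}y_{k,j}\varphi^{(r)}_k(t)\varphi_j(\tau)$.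 **Theorem.** Let $1\le s<2$, $1\le p\le\infty$, $\mu_1>2r-1/s+1/2$, and put $\nu=\mu_1-2r+1/s-1/2>0$ and $a=1/(\mu_1-1/p+1/s)$ (with $1/\infty=0$). Let $\mu_2\ge\nu$. The series for $f^{(r,0)}$ converges unconditionally in $L_2$ whenever $\|f\|_{s,\overline\mu}<\infty$. Moreover, let $A,B>0$ be arbitrary. The constants below are positive and depend only on $r,s,p,\mu_1,\mu_2,A,B$ and, where it occurs, on $\gamma$; throughout $0<\delta<1$, and $N,n\ge0$ are integers. (a) There are $c,C$ such that, whenever $A\delta^{-a}\le N\le B\delta^{-a}$, $$R_{N,\delta}\ge cN^{-\nu},\qquad R_{N,\delta}\ge c\,\delta^{a\nu},$$ and, if $\mu_2>\nu$, also $$R_{N,\delta}\le CN^{-\nu},\qquad R_{N,\delta}\le C\delta^{a\nu}.$$ Thus $R_{N,\delta}\asymp N^{-\nu}\asymp\delta^{a\nu}$ if $\mu_2>\nu$. The order is attained by the truncation method with any $\gamma$ such that $1<\gamma\le\mu_2/\nu$: (i) there are $c,C$ such that, whenever $A\delta^{-a}\le n\le B\delta^{-a}$, $\operatorname{card}\Gamma_{n,\gamma}\le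 C\delta^{-a}$ and $c\,\delta^{a\nu}\le\varepsilon_\delta(\mathcal D_{n,\gamma})\le C\delta^{a\nu}$; (ii) there are $A',B',C$ and $\delta_0\in(0,1)$ such that for all $\delta\le\delta_0$ and all $N$ with $A\delta^{-a}\le N\le B\delta^{-a}$ there is an $n$ with $A'\delta^{-a}\le n\le B'\delta^{-a}$, $\operatorname{card}\Gamma_{n,\gamma}\le N$ and $\varepsilon_\delta(\mathcal D_{n,\gamma})\le CN^{-\nu}$. (b) There are $c,C$ such that, whenever $N\ge2$ and $A\delta^{-a}\ln\frac1\delta\le N\le B\delta^{-a}\ln\frac1\delta$, $$cN^{-\nu}\le R_{N,\delta}\le C(N/\ln N)^{-\nu},\qquad c\,\delta^{a\nu}\ln^{-\nu}\tfrac1\delta\le R_{N,\delta}\le C\delta^{a\nu}.$$ The upper bounds are attained by the truncation method with $\gamma=1$: (i) there is $C$ such that, whenever $A\delta^{-a}\le n\le B\delta^{-a}$, $\varepsilon_\delta(\mathcal D_{n,1})\le C\delta^{a\nu}$ and, if $\delta\le1/2$, $\operatorname{card}\Gamma_{n,1}\le C\delta^{-a}\ln\frac1\delta$; (ii) there are $A',B',C$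 and $\delta_0\in(0,1)$ such that for all $\delta\le\delta_0$ and all $N$ with $A\delta^{-a}\ln\frac1\delta\le N\le B\delta^{-a}\ln\frac1\delta$ there is an $n$ with $A'\delta^{-a}\le n\le B'\delta^{-a}$, $\operatorname{card}\Gamma_{n,1}\le N$, $\varepsilon_\delta(\mathcal D_{n,1})\le C(N/\ln N)^{-\nu}$ and $\varepsilon_\delta(\mathcal D_{n,1})\le C\delta^{a\nu}$. -/

import Mathlib

open MeasureTheory Polynomial
open scoped ENNReal

namespace GalerkinRadius

noncomputable section

/-- The orthonormal Legendre polynomial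
`φ_k(t) = √(k + 1/2) (2^k k!)⁻¹ (d/dt)^k (t² - 1)^k` on `[-1,1]`. -/
def legendrePoly (k : ℕ) : ℝ[X] :=
  C (Real.sqrt ((k : ℝ) + 1 / 2) * ((2 : ℝ) ^ k * (k.factorial : ℝ))⁻¹) *
    derivative^[k] ((X ^ 2 - 1) ^ k)

/-- The square `Q = [-1,1]²`. -/
def square : Set (ℝ × ℝ) := Set.Icc (-1) 1 ×ˢ Set.Icc (-1) 1

/-- The real Hilbert space `L₂(Q)`. -/
abbrev L2Q : Type := Lp ℝ 2 (volume.restrict square)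

/-- The function `(t,τ) ↦ φ_k^{(r)}(t) φ_j(τ)`, for `q = (k,j)`. -/
def legendreFun (r : ℕ) (q : ℕ × ℕ) (x : ℝ × ℝ) : ℝ :=
  (derivative^[r] (legendrePoly q.1)).eval x.1 * (legendrePoly q.2).eval x.2

theorem memLp_legendreFun (r : ℕ) (q : ℕ × ℕ) :
    MemLp (legendreFun r q) 2 (volume.restrict square) := by
  have hc : Continuous (legendreFun r q) := by
    unfold legendreFun
    fun_prop
  have hK : IsCompact square := isCompact_Icc.prod isCompact_Icc
  have : IsFiniteMeasure (volume.restrict square) := isFiniteMeasure_restrict.2 hK.measure_lt_top.ne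
  obtain ⟨M, hM⟩ := hK.exists_bound_of_continuousOn hc.continuousOn
  refine MemLp.of_bound hc.aestronglyMeasurable M ?_
  exact (ae_restrict_iff' hK.measurableSet).2 (Filter.Eventually.of_forall hM)

/-- `φ_k^{(r)}(t) φ_j(τ)` as an element of `L₂(Q)`, for `q = (k,j)`. -/
def legendreL2 (r : ℕ) (q : ℕ × ℕ) : L2Q := (memLp_legendreFun r q).toLp (legendreFun r q)

/-- The Fourier-Legendre coefficient `⟨f, φ_{k,j}⟩`, for `q = (k,j)`. -/
def coeff (f : L2Q) (q : ℕ × ℕ) : ℝ := inner ℝ f (legendreL2 0 q)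

/-- The norm `‖f‖_{s,μ} = (∑_{k,j} max(1,k)^{sμ₁} max(1,j)^{sμ₂} |⟨f, φ_{k,j}⟩|^s)^{1/s}`,
with value `∞` if the series diverges. -/
def weightedNorm (s μ₁ μ₂ : ℝ) (f : L2Q) : ℝ≥0∞ :=
  (∑' q : ℕ × ℕ, ENNReal.ofReal
    ((max 1 (q.1 : ℝ)) ^ (s * μ₁) * (max 1 (q.2 : ℝ)) ^ (s * μ₂) * |coeff f q| ^ s)) ^ (1 / s)

/-- The class `L^μ_{s,2}`: the unit ball of the weighted norm. -/
def smoothClass (s μ₁ μ₂ : ℝ) : Set L2Q := {f | weightedNorm s μ₁ μ₂ f ≤ 1}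

/-- The term of the series of `f^{(r,0)}` with `k = r + q.1` and `j = q.2`. -/
def derivTerm (r : ℕ) (f : L2Q) (q : ℕ × ℕ) : L2Q :=
  coeff f (r + q.1, q.2) • legendreL2 r (r + q.1, q.2)

/-- The derivative `f^{(r,0)} = ∑_{k ≥ r} ∑_{j ≥ 0} ⟨f, φ_{k,j}⟩ φ_k^{(r)}(t) φ_j(τ)`,
summed (unconditionally) in `L₂(Q)`. -/
def partialDeriv (r : ℕ) (f : L2Q) : L2Q := ∑' q : ℕ × ℕ, derivTerm r f q

/-- The numbers `y` are perturbed Fourier-Legendre coefficients of `f`: the sequence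
`ξ_{k,j} = ⟨f, φ_{k,j}⟩ - y_{k,j}` lies in `ℓ_p` and its norm is at most `δ`. -/
def IsPerturbation (p : ℝ≥0∞) (δ : ℝ) (f : L2Q) (y : ℕ × ℕ → ℝ) : Prop :=
  ∃ ξ : lp (fun _ : ℕ × ℕ => ℝ) p, ‖ξ‖ ≤ δ ∧ ∀ q, coeff f q - y q = ξ q

/-- An algorithm that uses the coefficients with indices in `Ω`: an arbitrary map
`ℝ^Ω → L₂(Q)`. -/
abbrev Algorithm (Ω : Finset (ℕ × ℕ)) : Type := (Ω → ℝ) → L2Q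

/-- The worst-case error of an algorithm over the class and over all `δ`-perturbations. -/
def algError (r : ℕ) (s μ₁ μ₂ : ℝ) (p : ℝ≥0∞) (δ : ℝ) {Ω : Finset (ℕ × ℕ)}
    (ψ : Algorithm Ω) : ℝ≥0∞ :=
  ⨆ (f : L2Q) (_ : f ∈ smoothClass s μ₁ μ₂) (y : ℕ × ℕ → ℝ) (_ : IsPerturbation p δ f y),
    ENNReal.ofReal ‖partialDeriv r f - ψ (fun q => y q)‖

/-- The minimal radius of Galerkin information `R^{(r,0)}_{N,δ}(L^μ_{s,2}, L₂, ℓ_p)`: the least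
error over all finite index sets `Ω ⊆ [r,∞) × [0,∞)` with at most `N` points and all algorithms
on `Ω`. -/
def minimalRadius (r : ℕ) (s μ₁ μ₂ : ℝ) (p : ℝ≥0∞) (N : ℕ) (δ : ℝ) : ℝ≥0∞ :=
  ⨅ (Ω : Finset (ℕ × ℕ)) (_ : (∀ q ∈ Ω, r ≤ q.1) ∧ Ω.card ≤ N) (ψ : Algorithm Ω),
    algError r s μ₁ μ₂ p δ ψ

/-- The hyperbolic cross
`Γ_{n,γ} = {(k,j) : k j^γ ≤ n, k = r,…,n, j = 0,…,(n/r)^{1/γ}}`. -/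
def hypCross (r n : ℕ) (γ : ℝ) : Finset (ℕ × ℕ) :=
  (Finset.Icc r n ×ˢ Finset.range (⌊((n : ℝ) / r) ^ (1 / γ)⌋₊ + 1)).filter
    (fun q => (q.1 : ℝ) * (q.2 : ℝ) ^ γ ≤ n)

/-- The truncation method `∑_{(k,j) ∈ Γ_{n,γ}} y_{k,j} φ_k^{(r)}(t) φ_j(τ)`. -/
def truncation (r n : ℕ) (γ : ℝ) : Algorithm (hypCross r n γ) :=
  fun y => ∑ q : hypCross r n γ, y q • legendreL2 r q

end

end GalerkinRadius

/-! The upper bounds split the error of truncation into the part of `f` outside the cross and the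
propagated noise. Both are treated row by row. Rows with different `j` are orthogonal, and inside a
row `φ_k^{(r)}` is expanded in Legendre polynomials `φ_l`, `l < k`, with coefficients at most a
constant times `k^{2r-3/2} √(l+1/2)` (`abs_derivCoeff_le`). Thus the norm squared is controlled by
`∑_j ∑_l (l+1/2) (∑_{k>l} |x_{k,j}| k^{2r-3/2})²` (`norm_sq_sum_legendreL2_le`).

Tail (`exists_norm_sum_tail_le`): with `m = n / max(1,j)^γ`, Hölder in `k` turns the inner sum into
`max(l,m)^{-(ν+1)}` times the weighted `ℓ_s` norm of the row, and the sum over `l` gives `m^{-2ν}`.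
The loss `max(1,j)^{γν}` is absorbed by the weight as long as `γν ≤ μ₂`, and the rows add up because
`s ≤ 2`. The result is `n^{-ν}`.

Noise (`exists_norm_sum_noise_le`): a row has at most `m` entries, so it contributes at most a
constant times `δ m^e` with `e = 2r + 1/2 - 1/p`. Since `e ≥ 1`, the squares are summable over `j`
already for `γ = 1`, and the noise costs `δ n^e` with no logarithm. As `ν + e = 1/a`, the choice `n
≍ δ^{-a}` makes both errors of order `δ^{aν}`. The parameter `γ` otherwise enters only through the
size of the cross: `O(n)` for `γ > 1`, and `O(n log n)` for `γ = 1`, which is the source of the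
logarithms in (b).

Lower bound (`exists_le_algError`): this needs no noise. Among `2M` consecutive degrees of order
`M`, at least `M` are not first coordinates of points of `Ω`. An equal-weight sum of those `φ_k(t)
φ_0(τ)`, scaled into the class, is invisible to the information, and so is its negative. Hence any
algorithm errs by at least the norm of its derivative. All `φ_k^{(r)}(1)` are positive of order
`k^{2r+1/2}`, so nothing cancels at the endpoint, and `p(1)² ≤ (n²/2) ‖p‖²` for degree below `n`
converts the endpoint value into a norm of order `M^{-ν}`. -/

namespace GalerkinRadius

noncomputable section

/-! ### Legendre polynomials -/

/-- The integral over `[-1,1]` as a linear functional on polynomials. -/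
def polyInt : ℝ[X] →ₗ[ℝ] ℝ where
  toFun p := ∫ x in (-1 : ℝ)..1, p.eval x
  map_add' p q := by
    simp only [eval_add]
    exact intervalIntegral.integral_add (p.continuous.intervalIntegrable _ _)
      (q.continuous.intervalIntegrable _ _)
  map_smul' c p := by
    simp only [eval_smul, smul_eq_mul, RingHom.id_apply]
    exact intervalIntegral.integral_const_mul _ _

theorem polyInt_apply (p : ℝ[X]) : polyInt p = ∫ x in (-1 : ℝ)..1, p.eval x := rfl

theorem polyInt_C_mul (c : ℝ) (p : ℝ[X]) : polyInt (C c * p) = c * polyInt p := by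
  rw [← smul_eq_C_mul, map_smul, smul_eq_mul]

theorem polyInt_derivative (p : ℝ[X]) : polyInt (derivative p) = p.eval 1 - p.eval (-1) := by
  rw [polyInt_apply]
  exact intervalIntegral.integral_eq_sub_of_hasDerivAt (fun x _ => p.hasDerivAt x)
    ((derivative p).continuous.intervalIntegrable _ _)

theorem eval_iterate_derivative (p : ℝ[X]) (m : ℕ) (a : ℝ) :
    (derivative^[m] p).eval a = m.factorial * (taylor a p).coeff m := by
  rw [taylor_coeff, ← factorial_smul_hasseDeriv]
  simp

/-- At an endpoint `X² - 1` shifts to `X (X + 2a)`, so all derivatives of the Rodrigues power at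
`±1` can be read off as binomial coefficients. -/
theorem taylor_rodrigues (k : ℕ) {a : ℝ} (ha : a ^ 2 = 1) :
    taylor a ((X ^ 2 - 1 : ℝ[X]) ^ k) = X ^ k * (X + C (2 * a)) ^ k := by
  rw [taylor_pow, ← mul_pow]
  congr 1
  have : (C a : ℝ[X]) ^ 2 = 1 := by rw [← C_pow, ha, C_1]
  rw [taylor_apply]
  simp only [sub_comp, pow_comp, X_comp, one_comp, C_mul]
  have h2 : (C 2 : ℝ[X]) = 2 := rfl
  rw [h2]
  linear_combination this

theorem eval_iterate_derivative_rodrigues (k m : ℕ) {a : ℝ} (ha : a ^ 2 = 1) :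
    (derivative^[k + m] ((X ^ 2 - 1 : ℝ[X]) ^ k)).eval a =
      (k + m).factorial * ((2 * a) ^ (k - m) * k.choose m) := by
  rw [eval_iterate_derivative, taylor_rodrigues k ha, coeff_X_pow_mul', if_pos (by omega),
    Nat.add_sub_cancel_left, coeff_X_add_C_pow]

theorem eval_iterate_derivative_rodrigues_of_lt {k m : ℕ} (h : m < k) {a : ℝ} (ha : a ^ 2 = 1) :
    (derivative^[m] ((X ^ 2 - 1 : ℝ[X]) ^ k)).eval a = 0 := by
  rw [eval_iterate_derivative, taylor_rodrigues k ha, coeff_X_pow_mul', if_neg (by omega),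
    mul_zero]

/-- Integration by parts `m` times: derivatives of order below `k` vanish at `±1`, so there are no
boundary terms, and each step lowers the degree of `q`. -/
theorem polyInt_iterate_derivative_mul_eq_zero {k : ℕ} :
    ∀ {m : ℕ}, m ≤ k → ∀ {q : ℝ[X]}, q.degree < m →
      polyInt (derivative^[m] ((X ^ 2 - 1 : ℝ[X]) ^ k) * q) = 0
  | 0, _, q, hq => by
    have : q = 0 := by
      rw [← degree_eq_bot]
      exact WithBot.lt_coe_bot.mp hq
    simp [this]
  | m + 1, hm, q, hq => by
    set w := derivative^[m] ((X ^ 2 - 1 : ℝ[X]) ^ k) with hw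
    have h1 : derivative^[m + 1] ((X ^ 2 - 1 : ℝ[X]) ^ k) * q =
        derivative (w * q) - w * derivative q := by
      rw [Function.iterate_succ_apply', derivative_mul]
      ring
    have h2 : (derivative q).degree < m := by
      by_cases h0 : q.natDegree = 0
      · rw [derivative_of_natDegree_zero h0]
        simp
      · have hq0 : q ≠ 0 := by rintro rfl; simp at h0
        have h3 : q.natDegree < m + 1 := by
          rwa [← natDegree_lt_iff_degree_lt hq0] at hq
        have h4 : q.natDegree ≤ m := by omega
        refine lt_of_lt_of_le (degree_derivative_lt hq0) ?_
        exact degree_le_of_natDegree_le h4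
    rw [h1, map_sub, polyInt_derivative, polyInt_iterate_derivative_mul_eq_zero (by omega) h2,
      eval_mul, eval_mul, hw, eval_iterate_derivative_rodrigues_of_lt (by omega) (by norm_num),
      eval_iterate_derivative_rodrigues_of_lt (by omega) (by norm_num)]
    simp

/-- The normalizing factor of the Legendre polynomials. -/
def legendreNorm (k : ℕ) : ℝ := Real.sqrt ((k : ℝ) + 1 / 2) * ((2 : ℝ) ^ k * (k.factorial : ℝ))⁻¹

theorem legendrePoly_eq (k : ℕ) : legendrePoly k =
    C (legendreNorm k) * derivative^[k] ((X ^ 2 - 1) ^ k) := rfl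

theorem legendreNorm_pos (k : ℕ) : 0 < legendreNorm k := by
  unfold legendreNorm
  positivity

theorem polyInt_legendrePoly_mul_eq_zero {k : ℕ} {q : ℝ[X]} (hq : q.degree < k) :
    polyInt (legendrePoly k * q) = 0 := by
  rw [legendrePoly_eq, mul_assoc, polyInt_C_mul,
    polyInt_iterate_derivative_mul_eq_zero le_rfl hq, mul_zero]

theorem iterate_derivative_legendrePoly (r k : ℕ) : derivative^[r] (legendrePoly k) =
    C (legendreNorm k) * derivative^[k + r] ((X ^ 2 - 1) ^ k) := by
  rw [legendrePoly_eq, iterate_derivative_C_mul, ← Function.iterate_add_apply, add_comm]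

theorem eval_one_iterate_derivative_legendrePoly (r k : ℕ) :
    (derivative^[r] (legendrePoly k)).eval 1 =
      legendreNorm k * ((k + r).factorial * (2 ^ (k - r) * k.choose r)) := by
  rw [iterate_derivative_legendrePoly, eval_mul, eval_C,
    eval_iterate_derivative_rodrigues _ _ (by norm_num), mul_one]

theorem eval_one_legendrePoly (k : ℕ) : (legendrePoly k).eval 1 = √((k : ℝ) + 1 / 2) := by
  have := eval_one_iterate_derivative_legendrePoly 0 k
  simp only [Function.iterate_zero, id] at this
  rw [this, legendreNorm]
  simp
  field_simp

theorem eval_neg_one_legendrePoly (k : ℕ) :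
    (legendrePoly k).eval (-1) = (-1) ^ k * √((k : ℝ) + 1 / 2) := by
  have := eval_iterate_derivative_rodrigues k 0 (a := -1) (by norm_num)
  rw [add_zero] at this
  rw [legendrePoly_eq, eval_mul, eval_C, this, legendreNorm]
  simp
  rw [neg_pow]
  field_simp

theorem natDegree_legendrePoly_le (k : ℕ) : (legendrePoly k).natDegree ≤ k := by
  rw [legendrePoly_eq]
  refine (natDegree_C_mul_le _ _).trans ((natDegree_iterate_derivative _ _).trans ?_)
  have : ((X ^ 2 - 1 : ℝ[X]) ^ k).natDegree ≤ k * 2 := by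
    refine natDegree_pow_le.trans (Nat.mul_le_mul_left _ ?_)
    compute_degree
  omega

theorem coeff_legendrePoly_ne_zero (k : ℕ) : (legendrePoly k).coeff k ≠ 0 := by
  have hm : ((X ^ 2 - 1 : ℝ[X]) ^ k).coeff (k + k) = 1 := by
    have h1 : (X ^ 2 - 1 : ℝ[X]).Monic := by
      have := monic_X_pow_sub_C (1 : ℝ) (n := 2) (by norm_num)
      simpa using this
    have h2 : ((X ^ 2 - 1 : ℝ[X]) ^ k).natDegree = k + k := by
      have h3 : (X ^ 2 - 1 : ℝ[X]).natDegree = 2 := by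
        have := natDegree_X_pow_sub_C (R := ℝ) (n := 2) (r := 1)
        simpa using this
      rw [h1.natDegree_pow, h3]
      ring
    have := (h1.pow k).coeff_natDegree
    rwa [h2] at this
  rw [legendrePoly_eq, coeff_C_mul, coeff_iterate_derivative, hm]
  refine mul_ne_zero (legendreNorm_pos k).ne' ?_
  simp

theorem degree_iterate_derivative_legendrePoly_le (r k : ℕ) :
    (derivative^[r] (legendrePoly k)).degree ≤ k := by
  refine degree_le_of_natDegree_le ((natDegree_iterate_derivative _ _).trans ?_)
  have := natDegree_legendrePoly_le k
  omega

theorem degree_legendrePoly_lt {k l : ℕ} (h : l < k) : (legendrePoly l).degree < k :=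
  (degree_le_of_natDegree_le (natDegree_legendrePoly_le l)).trans_lt (by exact_mod_cast h)

theorem degree_iterate_derivative_legendrePoly_lt {r : ℕ} (hr : 1 ≤ r) (k : ℕ) :
    (derivative^[r] (legendrePoly k)).degree < k := by
  obtain rfl | hk := Nat.eq_zero_or_pos k
  · rw [iterate_derivative_eq_zero (by have := natDegree_legendrePoly_le 0; omega)]
    simp
  · refine lt_of_le_of_lt (degree_le_of_natDegree_le (natDegree_iterate_derivative _ _)) ?_
    have := natDegree_legendrePoly_le k
    exact_mod_cast (by omega : (legendrePoly k).natDegree - r < k)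

/-- The integral of `(X φ²)'` is `φ(1)² + φ(-1)² = 2k + 1`. On the other hand `X φ' - k φ` has
degree below `k` and is orthogonal to `φ`, so the same integral is `(2k + 1) ∫ φ²`. This avoids
evaluating a beta integral. -/
theorem polyInt_legendrePoly_mul_self (k : ℕ) :
    polyInt (legendrePoly k * legendrePoly k) = 1 := by
  set φ := legendrePoly k with hφ
  have h1 : polyInt (derivative (X * (φ * φ))) = 2 * k + 1 := by
    have hs := Real.mul_self_sqrt (show (0 : ℝ) ≤ (k : ℝ) + 1 / 2 by positivity)
    have hm : ((-1 : ℝ) ^ k) * (-1) ^ k = 1 := by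
      rw [← mul_pow]; simp
    rw [polyInt_derivative]
    simp only [eval_mul, eval_X, hφ, eval_one_legendrePoly, eval_neg_one_legendrePoly]
    linear_combination hs + (√((k : ℝ) + 1 / 2) * √((k : ℝ) + 1 / 2)) * hm + hs
  have hdeg : (X * derivative φ - C (k : ℝ) * φ).degree < (k : WithBot ℕ) := by
    rw [degree_lt_iff_coeff_zero]
    intro m hm
    rw [coeff_sub, coeff_C_mul]
    obtain rfl | hlt := hm.eq_or_lt
    · rcases k with _ | k
      · simp
      · rw [coeff_X_mul, coeff_derivative]
        push_cast
        ring
    · have h0 : φ.coeff m = 0 :=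
        coeff_eq_zero_of_natDegree_lt ((natDegree_legendrePoly_le k).trans_lt hlt)
      obtain ⟨m, rfl⟩ := Nat.exists_eq_succ_of_ne_zero (by omega : m ≠ 0)
      rw [coeff_X_mul, coeff_derivative, h0]
      simp
  have h2 := polyInt_legendrePoly_mul_eq_zero hdeg
  rw [← hφ, mul_sub, map_sub, mul_left_comm φ (C _), polyInt_C_mul] at h2
  have h3 : derivative (X * (φ * φ)) =
      φ * φ + C 2 * (φ * (X * derivative φ)) := by
    have h2 : (C 2 : ℝ[X]) = 2 := rfl
    rw [derivative_mul, derivative_mul, derivative_X, h2]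
    ring
  rw [h3, map_add, polyInt_C_mul] at h1
  have h4 : (2 * (k : ℝ) + 1) * (polyInt (φ * φ) - 1) = 0 := by linear_combination h1 - 2 * h2
  have h5 : (2 * (k : ℝ) + 1) ≠ 0 := by positivity
  have := (mul_eq_zero.1 h4).resolve_left h5
  linarith

theorem polyInt_legendrePoly_mul (k l : ℕ) :
    polyInt (legendrePoly k * legendrePoly l) = if k = l then 1 else 0 := by
  split_ifs with h
  · rw [h, polyInt_legendrePoly_mul_self]
  · rcases lt_or_gt_of_ne h with h | h
    · rw [mul_comm, polyInt_legendrePoly_mul_eq_zero (degree_legendrePoly_lt h)]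
    · rw [polyInt_legendrePoly_mul_eq_zero (degree_legendrePoly_lt h)]

/-- Subtract the multiple of `φ_n` that cancels the leading coefficient and recurse; orthonormality
identifies the multipliers. -/
theorem eq_sum_legendrePoly : ∀ {n : ℕ} {p : ℝ[X]}, p.degree < n →
    p = ∑ l ∈ Finset.range n, C (polyInt (p * legendrePoly l)) * legendrePoly l
  | 0, p, hp => by
    rw [Finset.range_zero, Finset.sum_empty, ← degree_eq_bot]
    exact WithBot.lt_coe_bot.mp hp
  | n + 1, p, hp => by
    set t := p.coeff n / (legendrePoly n).coeff n with ht
    set q := p - C t * legendrePoly n with hq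
    have hdeg : q.degree < n := by
      rw [degree_lt_iff_coeff_zero]
      intro m hm
      rw [hq, coeff_sub, coeff_C_mul]
      obtain rfl | hlt := hm.eq_or_lt
      · rw [ht, div_mul_cancel₀ _ (coeff_legendrePoly_ne_zero _), sub_self]
      · rw [coeff_eq_zero_of_natDegree_lt ((natDegree_legendrePoly_le n).trans_lt hlt),
          (degree_lt_iff_coeff_zero _ _).1 hp m (by omega)]
        simp
    have hpq : p = q + C t * legendrePoly n := by rw [hq]; ring
    have hcoef : ∀ l, polyInt (p * legendrePoly l) =
        polyInt (q * legendrePoly l) + t * (if n = l then 1 else 0) := by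
      intro l
      rw [hpq, add_mul, map_add, mul_assoc, polyInt_C_mul, polyInt_legendrePoly_mul]
    have hn : polyInt (p * legendrePoly n) = t := by
      rw [hcoef, mul_comm q, polyInt_legendrePoly_mul_eq_zero hdeg]
      simp
    rw [Finset.sum_range_succ, hn]
    nth_rw 1 [hpq]
    congr 1
    nth_rw 1 [eq_sum_legendrePoly hdeg]
    refine Finset.sum_congr rfl fun l hl => ?_
    rw [hcoef, if_neg (by have := Finset.mem_range.1 hl; omega)]
    simp

/-- The Legendre coefficients of the derivatives of the Legendre polynomials. -/
def derivCoeff (r k l : ℕ) : ℝ := polyInt (derivative^[r] (legendrePoly k) * legendrePoly l)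

theorem derivCoeff_eq_zero {r k l : ℕ} (hr : 1 ≤ r) (h : k ≤ l) : derivCoeff r k l = 0 := by
  rw [derivCoeff, mul_comm]
  refine polyInt_legendrePoly_mul_eq_zero ?_
  exact (degree_iterate_derivative_legendrePoly_lt hr k).trans_le (by exact_mod_cast h)

theorem iterate_derivative_eq_sum {r k n : ℕ} (hr : 1 ≤ r) (h : k ≤ n) :
    derivative^[r] (legendrePoly k) =
      ∑ l ∈ Finset.range n, C (derivCoeff r k l) * legendrePoly l :=
  eq_sum_legendrePoly ((degree_iterate_derivative_legendrePoly_lt hr k).trans_le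
    (by exact_mod_cast h))

/-- For `l < k`, integration by parts leaves only the boundary terms: `φ_l'` has degree below `k`,
so `∫ φ_k φ_l' = 0`. -/
theorem abs_derivCoeff_one_le (k l : ℕ) :
    |derivCoeff 1 k l| ≤ 2 * √((k : ℝ) + 1 / 2) * √((l : ℝ) + 1 / 2) := by
  rcases le_or_gt k l with h | h
  · rw [derivCoeff_eq_zero le_rfl h]
    simp only [abs_zero]
    positivity
  have h1 : derivative^[1] (legendrePoly k) * legendrePoly l =
      derivative (legendrePoly k * legendrePoly l) -
        legendrePoly k * derivative (legendrePoly l) := by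
    rw [Function.iterate_one, derivative_mul]
    ring
  have h2 : (derivative (legendrePoly l)).degree < k :=
    (degree_iterate_derivative_legendrePoly_le 1 l).trans_lt (by exact_mod_cast h)
  rw [derivCoeff, h1, map_sub, polyInt_legendrePoly_mul_eq_zero h2, sub_zero, polyInt_derivative,
    eval_mul, eval_mul, eval_one_legendrePoly, eval_one_legendrePoly, eval_neg_one_legendrePoly,
    eval_neg_one_legendrePoly]
  refine (abs_sub _ _).trans ?_
  simp only [abs_mul, abs_pow, abs_neg, abs_one, one_pow, one_mul,
    abs_of_nonneg (Real.sqrt_nonneg _)]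
  linarith

theorem derivCoeff_succ {r : ℕ} (hr : 1 ≤ r) (k l : ℕ) :
    derivCoeff (r + 1) k l = ∑ m ∈ Finset.range k, derivCoeff r k m * derivCoeff 1 m l := by
  rw [derivCoeff, Function.iterate_succ_apply', iterate_derivative_eq_sum hr le_rfl,
    derivative_sum, Finset.sum_mul, map_sum]
  refine Finset.sum_congr rfl fun m _ => ?_
  rw [derivative_C_mul, mul_assoc, polyInt_C_mul]
  rfl

theorem sum_range_add_half (n : ℕ) :
    ∑ m ∈ Finset.range n, ((m : ℝ) + 1 / 2) = (n : ℝ) ^ 2 / 2 := by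
  induction n with
  | zero => simp
  | succ n ih =>
    rw [Finset.sum_range_succ, ih]
    push_cast
    ring

/-- Coefficient matrices of successive derivatives multiply. The two factors `√(m+1/2)` at the
intermediate index combine, and `∑_{m<k} (m+1/2) = k²/2` yields a factor of order `k²` per
differentiation. -/
theorem abs_derivCoeff_succ_le (r k l : ℕ) :
    |derivCoeff (r + 1) k l| ≤
      2 ^ (r + 1) * √((k : ℝ) + 1 / 2) * (k : ℝ) ^ (2 * r) * √((l : ℝ) + 1 / 2) := by
  induction r generalizing l with
  | zero => simpa using abs_derivCoeff_one_le k l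
  | succ r ih =>
    rw [derivCoeff_succ (by omega)]
    refine (Finset.abs_sum_le_sum_abs _ _).trans ?_
    have h : ∀ m ∈ Finset.range k, |derivCoeff (r + 1) k m * derivCoeff 1 m l| ≤
        (2 ^ (r + 2) * √((k : ℝ) + 1 / 2) * (k : ℝ) ^ (2 * r) * √((l : ℝ) + 1 / 2)) *
          ((m : ℝ) + 1 / 2) := by
      intro m _
      rw [abs_mul]
      refine (mul_le_mul (ih m) (abs_derivCoeff_one_le m l) (abs_nonneg _)
        (by positivity)).trans_eq ?_
      have hs := Real.mul_self_sqrt (show (0 : ℝ) ≤ (m : ℝ) + 1 / 2 by positivity)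
      rw [pow_succ 2 (r + 1)]
      linear_combination (2 ^ (r + 1) * √((k : ℝ) + 1 / 2) * (k : ℝ) ^ (2 * r) * 2 *
        √((l : ℝ) + 1 / 2)) * hs
    refine (Finset.sum_le_sum h).trans ?_
    rw [← Finset.mul_sum, sum_range_add_half]
    have h0 : 0 ≤ 2 ^ (r + 1) * √((k : ℝ) + 1 / 2) * (k : ℝ) ^ (2 * r) * √((l : ℝ) + 1 / 2) *
        (k : ℝ) ^ 2 := by positivity
    have e : (k : ℝ) ^ (2 * (r + 1)) = (k : ℝ) ^ (2 * r) * (k : ℝ) ^ 2 := by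
      rw [← pow_add]; ring_nf
    rw [e]
    ring_nf at h0 ⊢
    linarith

theorem abs_derivCoeff_le {r : ℕ} (hr : 1 ≤ r) (k l : ℕ) :
    |derivCoeff r k l| ≤ 2 ^ (r + 1) * (k : ℝ) ^ (2 * (r : ℝ) - 3 / 2) * √((l : ℝ) + 1 / 2) := by
  obtain rfl | hk := Nat.eq_zero_or_pos k
  · rw [derivCoeff_eq_zero hr (Nat.zero_le _), abs_zero]
    positivity
  obtain ⟨r, rfl⟩ := Nat.exists_eq_add_of_le' hr
  refine (abs_derivCoeff_succ_le r k l).trans (mul_le_mul_of_nonneg_right ?_ (by positivity))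
  have hk1 : (1 : ℝ) ≤ k := by exact_mod_cast hk
  have h1 : √((k : ℝ) + 1 / 2) ≤ 2 * √(k : ℝ) := by
    rw [show (2 : ℝ) * √(k : ℝ) = √(4 * k) by
      rw [Real.sqrt_mul (by norm_num), show (4 : ℝ) = 2 ^ 2 by norm_num,
        Real.sqrt_sq (by norm_num)]]
    exact Real.sqrt_le_sqrt (by linarith)
  have h2 : (k : ℝ) ^ (2 * ((r + 1 : ℕ) : ℝ) - 3 / 2) = √(k : ℝ) * (k : ℝ) ^ (2 * r) := by
    rw [Real.sqrt_eq_rpow, ← Real.rpow_natCast, ← Real.rpow_add (by linarith)]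
    congr 1
    push_cast
    ring
  rw [h2]
  calc 2 ^ (r + 1) * √((k : ℝ) + 1 / 2) * (k : ℝ) ^ (2 * r)
      ≤ 2 ^ (r + 1) * (2 * √(k : ℝ)) * (k : ℝ) ^ (2 * r) := by gcongr
    _ = _ := by ring

/-- The endpoint value is `√(k+1/2) · (k+r)!/k! · 2^{-r} · C(k,r)`. The factorial quotient is at
least `k^r`, and `2r ≤ k` makes the binomial coefficient at least `(k/2)^r / r!`. -/
theorem le_eval_one_iterate_derivative_legendrePoly {r k : ℕ} (hk : 1 ≤ k) (h : 2 * r ≤ k) :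
    (4 ^ r * r.factorial : ℝ)⁻¹ * (k : ℝ) ^ (2 * (r : ℝ) + 1 / 2) ≤
      (derivative^[r] (legendrePoly k)).eval 1 := by
  have hk0 : (0 : ℝ) < k := by exact_mod_cast hk
  rw [eval_one_iterate_derivative_legendrePoly, legendreNorm]
  have h1 : (k : ℝ) ^ r * k.factorial ≤ (k + r).factorial := by
    have h2 := Nat.factorial_mul_pow_le_factorial (m := k) (n := r)
    have h3 : (k.factorial : ℝ) * (k + 1 : ℝ) ^ r ≤ (k + r).factorial := by exact_mod_cast h2
    refine le_trans ?_ h3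
    rw [mul_comm]
    gcongr
    linarith
  have h2 : ((k : ℝ) / 2) ^ r / r.factorial ≤ k.choose r := by
    refine le_trans ?_ (Nat.pow_le_choose (α := ℝ) r k)
    gcongr
    have : (k : ℝ) ≤ 2 * ((k + 1 - r : ℕ) : ℝ) := by exact_mod_cast (by omega)
    linarith
  have h3 : √(k : ℝ) ≤ √((k : ℝ) + 1 / 2) := Real.sqrt_le_sqrt (by linarith)
  have h4 : (k : ℝ) ^ (2 * (r : ℝ) + 1 / 2) = √(k : ℝ) * ((k : ℝ) ^ r * (k : ℝ) ^ r) := by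
    rw [Real.sqrt_eq_rpow, ← Real.rpow_natCast, ← Real.rpow_add hk0, ← Real.rpow_add hk0]
    congr 1
    ring
  have h5 : (2 : ℝ) ^ k = 2 ^ (k - r) * 2 ^ r := by
    rw [← pow_add]; congr 1; omega
  have h6 : (4 : ℝ) ^ r = 2 ^ r * 2 ^ r := by rw [← mul_pow]; norm_num
  calc (4 ^ r * r.factorial : ℝ)⁻¹ * (k : ℝ) ^ (2 * (r : ℝ) + 1 / 2)
      = √(k : ℝ) * ((2 : ℝ) ^ k * (k.factorial : ℝ))⁻¹ *
        (((k : ℝ) ^ r * k.factorial) * (2 ^ (k - r) * (((k : ℝ) / 2) ^ r / r.factorial))) := by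
        rw [h4, h5, h6, div_pow]
        field_simp
    _ ≤ _ := by gcongr

/-! ### Tensor products with Legendre polynomials in `L₂(Q)` -/

theorem memLp_tensor (j : ℕ) (p : ℝ[X]) :
    MemLp (fun x : ℝ × ℝ => p.eval x.1 * (legendrePoly j).eval x.2) 2
      (volume.restrict square) := by
  have hc : Continuous (fun x : ℝ × ℝ => p.eval x.1 * (legendrePoly j).eval x.2) := by fun_prop
  have hK : IsCompact square := isCompact_Icc.prod isCompact_Icc
  have : IsFiniteMeasure (volume.restrict square) := isFiniteMeasure_restrict.2 hK.measure_lt_top.ne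
  obtain ⟨M, hM⟩ := hK.exists_bound_of_continuousOn hc.continuousOn
  refine MemLp.of_bound hc.aestronglyMeasurable M ?_
  exact (ae_restrict_iff' hK.measurableSet).2 (Filter.Eventually.of_forall hM)

/-- The map `p ↦ p(t) φ_j(τ)` from polynomials to `L₂(Q)`. -/
def tensorL2 (j : ℕ) : ℝ[X] →ₗ[ℝ] L2Q where
  toFun p := (memLp_tensor j p).toLp _
  map_add' p q := by
    rw [← MemLp.toLp_add]
    congr 1
    ext x
    simp [add_mul]
  map_smul' c p := by
    rw [RingHom.id_apply, ← MemLp.toLp_const_smul]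
    congr 1
    ext x
    simp [mul_assoc]

theorem legendreL2_eq_tensorL2 (r k j : ℕ) :
    legendreL2 r (k, j) = tensorL2 j (derivative^[r] (legendrePoly k)) := rfl

theorem inner_tensorL2 (i j : ℕ) (p q : ℝ[X]) :
    inner ℝ (tensorL2 i p) (tensorL2 j q) = polyInt (p * q) * if i = j then 1 else 0 := by
  have h1 : inner ℝ (tensorL2 i p) (tensorL2 j q) =
      ∫ x in square, (p * q).eval x.1 * (legendrePoly i * legendrePoly j).eval x.2 := by
    rw [L2.inner_def]
    refine integral_congr_ae ?_
    filter_upwards [(memLp_tensor i p).coeFn_toLp, (memLp_tensor j q).coeFn_toLp] with x hx hy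
    change inner ℝ (((memLp_tensor i p).toLp _ : L2Q) x) (((memLp_tensor j q).toLp _ : L2Q) x) = _
    rw [hx, hy]
    simp only [RCLike.inner_apply, conj_trivial, eval_mul]
    ring
  have h2 : (volume : Measure (ℝ × ℝ)).restrict square =
      (volume.restrict (Set.Icc (-1) 1)).prod (volume.restrict (Set.Icc (-1) 1)) := by
    rw [Measure.prod_restrict]
    rfl
  have h3 : ∀ f : ℝ[X], ∫ x in Set.Icc (-1 : ℝ) 1, f.eval x = polyInt f := by
    intro f
    rw [polyInt_apply, intervalIntegral.integral_of_le (by norm_num), integral_Icc_eq_integral_Ioc]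
  rw [h1, h2, integral_prod_mul (fun x => (p * q).eval x)
    (fun x => (legendrePoly i * legendrePoly j).eval x), h3, h3, polyInt_legendrePoly_mul]

theorem coeff_tensorL2 (j : ℕ) (p : ℝ[X]) (q : ℕ × ℕ) :
    coeff (tensorL2 j p) q = polyInt (p * legendrePoly q.1) * if j = q.2 then 1 else 0 :=
  inner_tensorL2 j q.2 p (legendrePoly q.1)

theorem polyInt_mul_self_eq_sum {p : ℝ[X]} {n : ℕ} (hp : p.degree < n) :
    polyInt (p * p) = ∑ l ∈ Finset.range n, polyInt (p * legendrePoly l) ^ 2 := by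
  nth_rw 1 [eq_sum_legendrePoly hp]
  rw [Finset.sum_mul, map_sum]
  refine Finset.sum_congr rfl fun l _ => ?_
  rw [mul_assoc, polyInt_C_mul, mul_comm (legendrePoly l) p, sq]

/-- Cauchy–Schwarz in the Legendre expansion, where `∑_{l<n} φ_l(1)² = n²/2`. -/
theorem eval_one_sq_le {p : ℝ[X]} {n : ℕ} (hp : p.degree < n) :
    p.eval 1 ^ 2 ≤ (n : ℝ) ^ 2 / 2 * polyInt (p * p) := by
  have h1 : p.eval 1 =
      ∑ l ∈ Finset.range n, √((l : ℝ) + 1 / 2) * polyInt (p * legendrePoly l) := by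
    nth_rw 1 [eq_sum_legendrePoly hp]
    rw [eval_finsetSum]
    refine Finset.sum_congr rfl fun l _ => ?_
    rw [eval_mul, eval_C, eval_one_legendrePoly, mul_comm]
  rw [h1, polyInt_mul_self_eq_sum hp, ← sum_range_add_half]
  refine (Finset.sum_mul_sq_le_sq_mul_sq _ _ _).trans_eq ?_
  congr 1
  refine Finset.sum_congr rfl fun l _ => ?_
  rw [Real.sq_sqrt (by positivity)]

/-- Grouping by the second index gives orthogonal rows, because the undifferentiated factors `φ_j`
are orthonormal; the problem becomes one-dimensional in each row. -/
theorem norm_sq_sum_legendreL2 (r : ℕ) (F : Finset (ℕ × ℕ)) (x : ℕ × ℕ → ℝ) :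
    ‖∑ q ∈ F, x q • legendreL2 r q‖ ^ 2 = ∑ j ∈ F.image Prod.snd,
      polyInt ((∑ q ∈ F with q.2 = j, x q • derivative^[r] (legendrePoly q.1)) *
        (∑ q ∈ F with q.2 = j, x q • derivative^[r] (legendrePoly q.1))) := by
  have h1 : ∑ q ∈ F, x q • legendreL2 r q = ∑ j ∈ F.image Prod.snd,
      tensorL2 j (∑ q ∈ F with q.2 = j, x q • derivative^[r] (legendrePoly q.1)) := by
    rw [← Finset.sum_fiberwise_of_maps_to (g := Prod.snd) (t := F.image Prod.snd)
      (fun q hq => Finset.mem_image_of_mem _ hq)]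
    refine Finset.sum_congr rfl fun j _ => ?_
    rw [map_sum]
    refine Finset.sum_congr rfl fun q hq => ?_
    rw [map_smul, ← (Finset.mem_filter.1 hq).2]
    rfl
  rw [← real_inner_self_eq_norm_sq, h1, sum_inner]
  refine Finset.sum_congr rfl fun j hj => ?_
  rw [inner_sum, Finset.sum_eq_single_of_mem j hj]
  · rw [inner_tensorL2, if_pos rfl, mul_one]
  · intro i _ hi
    rw [inner_tensorL2, if_neg (Ne.symm hi), mul_zero]

theorem polyInt_sum_smul_mul (r : ℕ) (F : Finset (ℕ × ℕ)) (x : ℕ × ℕ → ℝ) (l : ℕ) :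
    polyInt ((∑ q ∈ F, x q • derivative^[r] (legendrePoly q.1)) * legendrePoly l) =
      ∑ q ∈ F, x q * derivCoeff r q.1 l := by
  rw [Finset.sum_mul, map_sum]
  refine Finset.sum_congr rfl fun q _ => ?_
  rw [smul_mul_assoc, map_smul, smul_eq_mul, derivCoeff]

/-- Parseval in each row combined with `abs_derivCoeff_le`. The restriction `l < q.1`, due to
differentiation lowering the degree, is what makes the later sums over `l` of the right order. Both
the tail and the noise estimates start here. -/
theorem norm_sq_sum_legendreL2_le {r : ℕ} (hr : 1 ≤ r) (F : Finset (ℕ × ℕ)) (x : ℕ × ℕ → ℝ)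
    {K : ℕ} (hK : ∀ q ∈ F, q.1 ≤ K) :
    ‖∑ q ∈ F, x q • legendreL2 r q‖ ^ 2 ≤ (2 ^ (r + 1)) ^ 2 * ∑ j ∈ F.image Prod.snd,
      ∑ l ∈ Finset.range K, ((l : ℝ) + 1 / 2) *
        (∑ q ∈ F with q.2 = j ∧ l < q.1, |x q| * (q.1 : ℝ) ^ (2 * (r : ℝ) - 3 / 2)) ^ 2 := by
  rw [norm_sq_sum_legendreL2, Finset.mul_sum]
  refine Finset.sum_le_sum fun j _ => ?_
  rw [polyInt_mul_self_eq_sum (n := K), Finset.mul_sum]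
  · refine Finset.sum_le_sum fun l _ => ?_
    rw [polyInt_sum_smul_mul]
    have h1 : |∑ q ∈ F with q.2 = j, x q * derivCoeff r q.1 l| ≤
        (2 ^ (r + 1) * √((l : ℝ) + 1 / 2)) * ∑ q ∈ F with q.2 = j ∧ l < q.1,
          |x q| * (q.1 : ℝ) ^ (2 * (r : ℝ) - 3 / 2) := by
      rw [← Finset.filter_filter, ← Finset.sum_filter_of_ne (p := fun q : ℕ × ℕ => l < q.1),
        Finset.mul_sum]
      · refine (Finset.abs_sum_le_sum_abs _ _).trans (Finset.sum_le_sum fun q _ => ?_)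
        rw [abs_mul]
        refine (mul_le_mul_of_nonneg_left (abs_derivCoeff_le hr q.1 l) (abs_nonneg _)).trans_eq ?_
        ring
      · intro q _ hne
        by_contra hq
        exact hne (by rw [derivCoeff_eq_zero hr (by omega), mul_zero])
    have h2 := Real.sq_sqrt (show (0 : ℝ) ≤ (l : ℝ) + 1 / 2 by positivity)
    rw [← sq_abs]
    refine (pow_le_pow_left₀ (abs_nonneg _) h1 2).trans_eq ?_
    rw [mul_pow, mul_pow, h2, mul_assoc]
  · refine (degree_sum_le _ _).trans_lt ?_
    rw [Finset.sup_lt_iff (by exact_mod_cast WithBot.bot_lt_coe K)]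
    intro q hq
    refine (degree_smul_le _ _).trans_lt ?_
    exact (degree_iterate_derivative_legendrePoly_lt hr q.1).trans_le
      (by exact_mod_cast hK q (Finset.mem_filter.1 hq).1)

/-! ### Sums of powers -/

/-- A telescoping majorant with an explicit constant. With `u = 1/k`, the bound `log(1+u) ≥ u/2`
gives `(1+u)^θ ≥ 1 + θu/2`, and `u ≤ 1` then gives `(1+u)^{-θ} ≤ 1 - θu/(2+θ)`. -/
theorem rpow_neg_le_sub {θ : ℝ} (hθ : 0 < θ) {k : ℕ} (hk : 1 ≤ k) :
    (k : ℝ) ^ (-1 - θ) ≤ (2 / θ + 1) * ((k : ℝ) ^ (-θ) - ((k + 1 : ℕ) : ℝ) ^ (-θ)) := by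
  have hk1 : (1 : ℝ) ≤ k := by exact_mod_cast hk
  have hk0 : (0 : ℝ) < k := by linarith
  set u : ℝ := (k : ℝ)⁻¹ with hu
  have hu0 : 0 < u := by positivity
  have hu1 : u ≤ 1 := inv_le_one_of_one_le₀ hk1
  have hlog : u / 2 ≤ Real.log (1 + u) := by
    have h1 := Real.one_sub_inv_le_log_of_pos (show 0 < 1 + u by linarith)
    refine le_trans ?_ h1
    rw [le_sub_iff_add_le, ← le_sub_iff_add_le', inv_le_iff_one_le_mul₀ (by linarith)]
    nlinarith
  have hpow : 1 + θ * u / 2 ≤ (1 + u) ^ θ := by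
    rw [Real.rpow_def_of_pos (by linarith)]
    have := Real.add_one_le_exp (Real.log (1 + u) * θ)
    nlinarith
  have h1 : ((k + 1 : ℕ) : ℝ) ^ (-θ) = (k : ℝ) ^ (-θ) * ((1 + u) ^ θ)⁻¹ := by
    rw [← Real.rpow_neg (by linarith), ← Real.mul_rpow hk0.le (by linarith)]
    congr 1
    rw [hu]
    push_cast
    field_simp
  have h2 : (k : ℝ) ^ (-1 - θ) = (k : ℝ) ^ (-θ) * u := by
    rw [show -1 - θ = -θ + -1 by ring, Real.rpow_add hk0, Real.rpow_neg_one]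
  have h3 : ((1 + u) ^ θ)⁻¹ ≤ (1 + θ * u / 2)⁻¹ := inv_anti₀ (by positivity) hpow
  rw [h1, h2, ← mul_one_sub, mul_left_comm]
  refine mul_le_mul_of_nonneg_left ?_ (by positivity)
  have h4 : (1 + θ * u / 2)⁻¹ ≤ 1 - u / (2 / θ + 1) := by
    rw [inv_le_iff_one_le_mul₀ (by positivity)]
    have h5 : u / (2 / θ + 1) = θ * u / (2 + θ) := by field_simp
    have h6 : (1 - θ * u / (2 + θ)) * (1 + θ * u / 2) - 1 =
        (θ * u) * (θ * (1 - u)) / (2 * (2 + θ)) := by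
      field_simp
      ring
    have h7 : 0 ≤ (θ * u) * (θ * (1 - u)) / (2 * (2 + θ)) := by
      have : 0 ≤ 1 - u := by linarith
      positivity
    rw [h5]
    linarith
  have h8 : u = (2 / θ + 1) * (u / (2 / θ + 1)) := by field_simp
  nth_rw 1 [h8]
  exact mul_le_mul_of_nonneg_left (by linarith) (by positivity)

theorem sum_rpow_tail_le {θ : ℝ} (hθ : 0 < θ) (S : Finset ℕ) {M : ℝ} (hM : 0 < M)
    (hS : ∀ k ∈ S, 1 ≤ k ∧ M ≤ k) :
    ∑ k ∈ S, (k : ℝ) ^ (-1 - θ) ≤ (2 / θ + 1) * M ^ (-θ) := by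
  obtain rfl | hne := S.eq_empty_or_nonempty
  · rw [Finset.sum_empty]
    positivity
  set a := S.min' hne with ha
  set b := S.max' hne with hb
  have haS := hS a (S.min'_mem hne)
  have hab : a ≤ b := S.min'_le b (S.max'_mem hne)
  have hsub : S ⊆ Finset.Ico a (b + 1) := fun k hk =>
    Finset.mem_Ico.2 ⟨S.min'_le k hk, Nat.lt_succ_of_le (S.le_max' k hk)⟩
  calc ∑ k ∈ S, (k : ℝ) ^ (-1 - θ) ≤ ∑ k ∈ Finset.Ico a (b + 1), (k : ℝ) ^ (-1 - θ) :=
        Finset.sum_le_sum_of_subset_of_nonneg hsub fun k _ _ => by positivity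
    _ ≤ ∑ k ∈ Finset.Ico a (b + 1),
        (2 / θ + 1) * ((k : ℝ) ^ (-θ) - ((k + 1 : ℕ) : ℝ) ^ (-θ)) :=
        Finset.sum_le_sum fun k hk =>
          rpow_neg_le_sub hθ (haS.1.trans (Finset.mem_Ico.1 hk).1)
    _ = (2 / θ + 1) * ((a : ℝ) ^ (-θ) - ((b + 1 : ℕ) : ℝ) ^ (-θ)) := by
        rw [← Finset.mul_sum]
        congr 1
        have := Finset.sum_Ico_sub (fun k : ℕ => -(k : ℝ) ^ (-θ)) (show a ≤ b + 1 by omega)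
        simp only [neg_sub_neg] at this
        rw [this]
    _ ≤ (2 / θ + 1) * M ^ (-θ) := by
        refine mul_le_mul_of_nonneg_left ?_ (by positivity)
        have h1 : (a : ℝ) ^ (-θ) ≤ M ^ (-θ) :=
          Real.rpow_le_rpow_of_nonpos hM haS.2 (by linarith)
        have h2 : (0 : ℝ) ≤ ((b + 1 : ℕ) : ℝ) ^ (-θ) := by positivity
        linarith

theorem sum_rpow_tail_le_of_snd {θ : ℝ} (hθ : 0 < θ) (S : Finset (ℕ × ℕ)) {M : ℝ} (hM : 0 < M)
    {j : ℕ} (hS : ∀ q ∈ S, q.2 = j ∧ 1 ≤ q.1 ∧ M ≤ q.1) :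
    ∑ q ∈ S, (q.1 : ℝ) ^ (-1 - θ) ≤ (2 / θ + 1) * M ^ (-θ) := by
  have h := sum_rpow_tail_le hθ (S.image Prod.fst) hM (by
    intro k hk
    obtain ⟨q, hq, rfl⟩ := Finset.mem_image.1 hk
    exact (hS q hq).2)
  rwa [Finset.sum_image] at h
  intro q hq q' hq' he
  exact Prod.ext he ((hS q hq).1.trans (hS q' hq').1.symm)

/-- Hölder with the conjugate exponent `t` of `s`: since `1 - 1/s = 1/t`, the power raised to `t` is
`k^{-1-(ν+1)t}`, whose tail is of order `M^{-(ν+1)t}`. For `s = 1` the conjugate exponent is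
infinite, and the supremum bound replaces Hölder. -/
theorem sum_mul_rpow_tail_le {s ν : ℝ} (hs : 1 ≤ s) (hν : 0 < ν) :
    ∃ C : ℝ, 0 < C ∧ ∀ (S : Finset (ℕ × ℕ)) (M : ℝ) (j : ℕ) (d : ℕ × ℕ → ℝ), 0 < M →
      (∀ q, 0 ≤ d q) → (∀ q ∈ S, q.2 = j ∧ 1 ≤ q.1 ∧ M ≤ q.1) →
      ∑ q ∈ S, d q * (q.1 : ℝ) ^ (-(ν + 2 - 1 / s)) ≤
        C * M ^ (-(ν + 1)) * (∑ q ∈ S, d q ^ s) ^ (1 / s) := by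
  obtain rfl | hs1 := hs.eq_or_lt
  · refine ⟨1, one_pos, fun S M j d hM hd hS => ?_⟩
    rw [one_mul, div_one, Real.rpow_one, Finset.mul_sum]
    refine Finset.sum_le_sum fun q hq => ?_
    rw [Real.rpow_one, mul_comm]
    refine mul_le_mul_of_nonneg_right ?_ (hd q)
    rw [show ν + 2 - 1 = ν + 1 by ring]
    exact Real.rpow_le_rpow_of_nonpos hM (hS q hq).2.2 (by linarith)
  · set t := s.conjExponent with ht
    have hst : s.HolderConjugate t := Real.HolderConjugate.conjExponent hs1
    have ht0 : 0 < t := hst.symm.pos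
    have hθ : 0 < (ν + 1) * t := by positivity
    refine ⟨(2 / ((ν + 1) * t) + 1) ^ (1 / t), by positivity, fun S M j d hM hd hS => ?_⟩
    have h1 := Real.inner_le_Lp_mul_Lq S d (fun q => (q.1 : ℝ) ^ (-(ν + 2 - 1 / s))) hst
    refine h1.trans ?_
    have h2 : ∑ q ∈ S, |d q| ^ s = ∑ q ∈ S, d q ^ s :=
      Finset.sum_congr rfl fun q _ => by rw [abs_of_nonneg (hd q)]
    have h3 : ∑ q ∈ S, |(q.1 : ℝ) ^ (-(ν + 2 - 1 / s))| ^ t =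
        ∑ q ∈ S, (q.1 : ℝ) ^ (-1 - (ν + 1) * t) := by
      refine Finset.sum_congr rfl fun q _ => ?_
      rw [abs_of_nonneg (by positivity), ← Real.rpow_mul (by positivity)]
      congr 1
      have h4 : 1 / s = 1 - 1 / t := by
        have := hst.inv_add_inv_eq_one
        simp only [one_div]
        linarith
      rw [h4]
      field_simp
      ring
    rw [h2, h3, mul_comm]
    refine mul_le_mul_of_nonneg_right ?_ (by
      exact Real.rpow_nonneg (Finset.sum_nonneg fun q _ => Real.rpow_nonneg (hd q) _) _)
    refine (Real.rpow_le_rpow (Finset.sum_nonneg fun q _ => by positivity)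
      (sum_rpow_tail_le_of_snd hθ S hM hS) (by positivity)).trans_eq ?_
    rw [Real.mul_rpow (by positivity) (by positivity), ← Real.rpow_mul hM.le]
    congr 2
    field_simp

theorem sum_add_half_le (K : ℕ) {m : ℝ} (hm : 0 ≤ m) :
    ∑ l ∈ Finset.range K with (l : ℕ) ≤ m, ((l : ℝ) + 1 / 2) ≤ (m + 1) ^ 2 / 2 := by
  have hsub : {l ∈ Finset.range K | ((l : ℕ) : ℝ) ≤ m} ⊆ Finset.range (⌊m⌋₊ + 1) := by
    intro l hl
    rw [Finset.mem_range, Nat.lt_succ_iff]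
    exact Nat.le_floor (Finset.mem_filter.1 hl).2
  refine (Finset.sum_le_sum_of_subset_of_nonneg hsub fun l _ _ => by positivity).trans ?_
  rw [sum_range_add_half]
  have := Nat.floor_le hm
  push_cast
  gcongr

/-- Split at `l = m`. Below, the maximum is constant and `(m+1)²/2 ≤ 5m²` because `m ≥ 1/2`; above,
`l + 1/2 ≤ 2l` reduces to the tail of `l^{-1-2ν}`. -/
theorem sum_add_half_mul_max_rpow_le {ν : ℝ} (hν : 0 < ν) (K : ℕ) {m : ℝ} (hm : 1 / 2 ≤ m) :
    ∑ l ∈ Finset.range K, ((l : ℝ) + 1 / 2) * (max (l : ℝ) m) ^ (-(2 * ν + 2)) ≤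
      (5 + 2 * (2 / (2 * ν) + 1)) * m ^ (-(2 * ν)) := by
  have hm0 : 0 < m := by linarith
  rw [← Finset.sum_filter_add_sum_filter_not _ (fun l : ℕ => (l : ℝ) ≤ m), add_mul]
  refine add_le_add ?_ ?_
  · have h1 : ∀ l ∈ {l ∈ Finset.range K | ((l : ℕ) : ℝ) ≤ m},
        ((l : ℝ) + 1 / 2) * (max (l : ℝ) m) ^ (-(2 * ν + 2)) =
          ((l : ℝ) + 1 / 2) * m ^ (-(2 * ν + 2)) := by
      intro l hl
      rw [max_eq_right (Finset.mem_filter.1 hl).2]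
    rw [Finset.sum_congr rfl h1, ← Finset.sum_mul]
    have h2 : m ^ (-(2 * ν)) = m ^ 2 * m ^ (-(2 * ν + 2)) := by
      rw [← Real.rpow_natCast, ← Real.rpow_add hm0]
      congr 1
      push_cast
      ring
    rw [h2, ← mul_assoc]
    refine mul_le_mul_of_nonneg_right ((sum_add_half_le K hm0.le).trans ?_) (by positivity)
    nlinarith
  · have h1 : ∀ l ∈ {l ∈ Finset.range K | ¬ ((l : ℕ) : ℝ) ≤ m},
        ((l : ℝ) + 1 / 2) * (max (l : ℝ) m) ^ (-(2 * ν + 2)) ≤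
          2 * (l : ℝ) ^ (-1 - 2 * ν) := by
      intro l hl
      have hl := not_le.1 (Finset.mem_filter.1 hl).2
      have hl0 : (0 : ℝ) < l := hm0.trans hl
      have hl1 : (1 : ℝ) ≤ l := by exact_mod_cast hl0
      rw [max_eq_left hl.le]
      have h3 : (l : ℝ) ^ (-1 - 2 * ν) = l * (l : ℝ) ^ (-(2 * ν + 2)) := by
        nth_rw 2 [← Real.rpow_one (l : ℝ)]
        rw [← Real.rpow_add hl0]
        congr 1
        ring
      rw [h3, ← mul_assoc]
      refine mul_le_mul_of_nonneg_right ?_ (by positivity)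
      linarith
    refine (Finset.sum_le_sum h1).trans ?_
    rw [← Finset.mul_sum, mul_assoc]
    refine mul_le_mul_of_nonneg_left ?_ (by norm_num)
    refine sum_rpow_tail_le (by positivity) _ hm0 fun l hl => ?_
    have hl := not_le.1 (Finset.mem_filter.1 hl).2
    exact ⟨by exact_mod_cast hm0.trans hl, hl.le⟩

theorem sum_rpow_le_rpow_sum {ι : Type*} (S : Finset ι) (f : ι → ℝ) (hf : ∀ i ∈ S, 0 ≤ f i) {t : ℝ}
    (ht : 1 ≤ t) : ∑ i ∈ S, f i ^ t ≤ (∑ i ∈ S, f i) ^ t := by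
  have hA := Finset.sum_nonneg hf
  have hsplit : ∀ y : ℝ, 0 ≤ y → y ^ t = y * y ^ (t - 1) := by
    intro y hy
    have := Real.rpow_add_of_nonneg hy zero_le_one (sub_nonneg.2 ht)
    rwa [add_sub_cancel, Real.rpow_one] at this
  rw [hsplit _ hA, Finset.sum_mul]
  refine Finset.sum_le_sum fun i hi => ?_
  rw [hsplit _ (hf i hi)]
  exact mul_le_mul_of_nonneg_left (Real.rpow_le_rpow (hf i hi)
    (Finset.single_le_sum hf hi) (by linarith)) (hf i hi)

theorem sum_abs_le_of_sum_rpow_le {ι : Type*} (F : Finset ι) {v : ι → ℝ} {t B : ℝ} (ht1 : 1 ≤ t)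
    (hB : 0 ≤ B) (h : ∑ q ∈ F, |v q| ^ t ≤ B ^ t) :
    ∑ q ∈ F, |v q| ≤ (F.card : ℝ) ^ (1 - t⁻¹) * B := by
  have ht0 : 0 < t := by linarith
  have h1 := Real.rpow_sum_le_const_mul_sum_rpow F v ht1
  refine (Real.rpow_le_rpow_iff (Finset.sum_nonneg fun _ _ => abs_nonneg _) (by positivity)
    ht0).1 ?_
  rw [Real.mul_rpow (by positivity) hB, ← Real.rpow_mul (by positivity),
    show (1 - t⁻¹) * t = t - 1 by field_simp]
  exact h1.trans (mul_le_mul_of_nonneg_left h (by positivity))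

/-- Hölder on a finite set. Writing the exponent with `(p⁻¹).toReal` covers `p = ∞`, where it equals
`0`. -/
theorem sum_abs_le_card_rpow_mul_norm {ι : Type*} {p : ℝ≥0∞} (hp : 1 ≤ p)
    (ξ : lp (fun _ : ι => ℝ) p) (F : Finset ι) :
    ∑ q ∈ F, |ξ q| ≤ (F.card : ℝ) ^ (1 - (p⁻¹).toReal) * ‖ξ‖ := by
  by_cases hpt : p = ⊤
  · subst hpt
    simp only [ENNReal.inv_top, ENNReal.toReal_zero, sub_zero, Real.rpow_one]
    rw [← nsmul_eq_mul]
    exact Finset.sum_le_card_nsmul _ _ _ fun q _ => lp.norm_apply_le_norm ENNReal.top_ne_zero ξ q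
  · set t := p.toReal with ht
    have ht1 : 1 ≤ t := by
      have := (ENNReal.toReal_le_toReal ENNReal.one_ne_top hpt).2 hp
      simpa using this
    have ht0 : 0 < t := by linarith
    rw [ENNReal.toReal_inv, ← ht]
    exact sum_abs_le_of_sum_rpow_le F ht1 (lp.norm_nonneg' ξ)
      (lp.sum_rpow_le_norm_rpow (ht ▸ ht0) ξ F)

/-! ### Upper bounds for finite sums -/

/-- The weight `max(1,k)^{μ₁} max(1,j)^{μ₂}` for `q = (k,j)`. -/
def weight (μ₁ μ₂ : ℝ) (q : ℕ × ℕ) : ℝ := (max 1 (q.1 : ℝ)) ^ μ₁ * (max 1 (q.2 : ℝ)) ^ μ₂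

theorem weight_nonneg (μ₁ μ₂ : ℝ) (q : ℕ × ℕ) : 0 ≤ weight μ₁ μ₂ q := by
  unfold weight
  positivity

/-- Stated for finite sets and arbitrary real `γ` with `γν ≤ μ₂`, so that it serves convergence of
the series and the trivial bound (`γ = 0`, `n = 1`) as well as the crosses. -/
theorem exists_norm_sum_tail_le {r : ℕ} (hr : 1 ≤ r) {s μ₁ μ₂ ν : ℝ} (hs : 1 ≤ s) (hs2 : s < 2)
    (hν : ν = μ₁ - 2 * r + 1 / s - 1 / 2) (hν0 : 0 < ν) :
    ∃ C : ℝ, 0 < C ∧ ∀ (γ n : ℝ) (F : Finset (ℕ × ℕ)) (x : ℕ × ℕ → ℝ), γ * ν ≤ μ₂ → 0 < n →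
      (∀ q ∈ F, 1 ≤ q.1 ∧ n ≤ q.1 * (max 1 (q.2 : ℝ)) ^ γ) →
      ‖∑ q ∈ F, x q • legendreL2 r q‖ ≤
        C * n ^ (-ν) * (∑ q ∈ F, (weight μ₁ μ₂ q * |x q|) ^ s) ^ (1 / s) := by
  obtain ⟨C₁, hC₁, hrow⟩ := sum_mul_rpow_tail_le hs hν0
  set C₂ : ℝ := 5 + 2 * (2 / (2 * ν) + 1) with hC₂
  have hC₂0 : 0 < C₂ := by positivity
  have hs0 : 0 < s := by linarith
  refine ⟨2 ^ (r + 1) * C₁ * √C₂, by positivity, fun γ n F x hγ hn hF => ?_⟩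
  set K := F.sup Prod.fst with hK
  have hKF : ∀ q ∈ F, q.1 ≤ K := fun q hq => Finset.le_sup (f := Prod.fst) hq
  set d : ℕ × ℕ → ℝ := fun q => weight μ₁ μ₂ q * |x q| with hd
  have hd0 : ∀ q, 0 ≤ d q := fun q => mul_nonneg (weight_nonneg _ _ _) (abs_nonneg _)
  set E : ℕ → ℝ := fun j => ∑ q ∈ F with q.2 = j, d q ^ s with hE
  have hE0 : ∀ j, 0 ≤ E j := fun j => Finset.sum_nonneg fun q _ => Real.rpow_nonneg (hd0 q) _
  have hrowj : ∀ j ∈ F.image Prod.snd, ∑ l ∈ Finset.range K, ((l : ℝ) + 1 / 2) *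
      (∑ q ∈ F with q.2 = j ∧ l < q.1, |x q| * (q.1 : ℝ) ^ (2 * (r : ℝ) - 3 / 2)) ^ 2 ≤
        (C₁ * n ^ (-ν)) ^ 2 * C₂ * E j ^ (2 / s) := by
    intro j _
    set J : ℝ := max 1 (j : ℝ) with hJ
    have hJ1 : 1 ≤ J := le_max_left _ _
    have hJ0 : 0 < J := by linarith
    -- In row `j` every `k` is at least `n / J^γ`. The floor `1/2` is harmless since `k ≥ 1`, and
    -- keeps `m` in the range required by the sum over `l`.
    set m : ℝ := max (n / J ^ γ) (1 / 2) with hm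
    have hm2 : 1 / 2 ≤ m := le_max_right _ _
    have hm0 : 0 < m := by linarith
    have hl : ∀ l : ℕ,
        ∑ q ∈ F with q.2 = j ∧ l < q.1, |x q| * (q.1 : ℝ) ^ (2 * (r : ℝ) - 3 / 2) ≤
          J ^ (-μ₂) * (C₁ * (max (l : ℝ) m) ^ (-(ν + 1)) * E j ^ (1 / s)) := by
      intro l
      have hS : ∀ q ∈ F.filter (fun q => q.2 = j ∧ l < q.1),
          q.2 = j ∧ 1 ≤ q.1 ∧ max (l : ℝ) m ≤ q.1 := by
        intro q hq
        obtain ⟨hqF, hqj, hql⟩ := Finset.mem_filter.1 hq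
        obtain ⟨h1, h2⟩ := hF q hqF
        have h1' : (1 : ℝ) ≤ q.1 := by exact_mod_cast h1
        refine ⟨hqj, h1, max_le (by exact_mod_cast hql.le) (max_le ?_ (by linarith))⟩
        rw [hqj] at h2
        rwa [div_le_iff₀ (by positivity)]
      have h1 := hrow _ (max (l : ℝ) m) j d (lt_max_of_lt_right hm0) hd0 hS
      have h2 : ∀ q ∈ F.filter (fun q => q.2 = j ∧ l < q.1),
          |x q| * (q.1 : ℝ) ^ (2 * (r : ℝ) - 3 / 2) =
            J ^ (-μ₂) * (d q * (q.1 : ℝ) ^ (-(ν + 2 - 1 / s))) := by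
        intro q hq
        obtain ⟨hqj, hq1, -⟩ := hS q hq
        have hq1' : (1 : ℝ) ≤ q.1 := by exact_mod_cast hq1
        -- The definition of `ν` amounts to `μ₁ - (2r - 3/2) = ν + 2 - 1/s`.
        have e1 : (q.1 : ℝ) ^ μ₁ * (q.1 : ℝ) ^ (-(ν + 2 - 1 / s)) =
            (q.1 : ℝ) ^ (2 * (r : ℝ) - 3 / 2) := by
          rw [← Real.rpow_add (by linarith)]
          congr 1
          rw [hν]
          ring
        have e2 : J ^ (-μ₂) * J ^ μ₂ = 1 := by
          rw [← Real.rpow_add hJ0, neg_add_cancel, Real.rpow_zero]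
        simp only [hd, weight]
        rw [hqj, max_eq_right hq1', ← e1, ← hJ]
        linear_combination -(|x q| * (q.1 : ℝ) ^ μ₁ * (q.1 : ℝ) ^ (-(ν + 2 - 1 / s))) * e2
      rw [Finset.sum_congr rfl h2, ← Finset.mul_sum]
      refine mul_le_mul_of_nonneg_left (h1.trans ?_) (by positivity)
      refine mul_le_mul_of_nonneg_left (Real.rpow_le_rpow ?_ ?_ (by positivity)) (by positivity)
      · exact Finset.sum_nonneg fun q _ => Real.rpow_nonneg (hd0 q) _
      · refine Finset.sum_le_sum_of_subset_of_nonneg ?_ fun q _ _ => Real.rpow_nonneg (hd0 q) _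
        intro q hq
        rw [Finset.mem_filter] at hq ⊢
        exact ⟨hq.1, hq.2.1⟩
    have hJm : J ^ (-μ₂) * m ^ (-ν) ≤ n ^ (-ν) := by
      have h1 : m ^ (-ν) ≤ (n / J ^ γ) ^ (-ν) :=
        Real.rpow_le_rpow_of_nonpos (by positivity) (le_max_left _ _) (by linarith)
      have h2 : (n / J ^ γ) ^ (-ν) = n ^ (-ν) * J ^ (γ * ν) := by
        rw [Real.div_rpow hn.le (by positivity), ← Real.rpow_mul hJ0.le, div_eq_mul_inv,
          ← Real.rpow_neg hJ0.le]
        congr 2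
        ring
      -- The weight in `j` pays for the shorter rows of the cross.
      have h3 : J ^ (γ * ν) ≤ J ^ μ₂ := Real.rpow_le_rpow_of_exponent_le hJ1 hγ
      calc J ^ (-μ₂) * m ^ (-ν) ≤ J ^ (-μ₂) * (n ^ (-ν) * J ^ μ₂) := by
            refine mul_le_mul_of_nonneg_left ((h1.trans_eq h2).trans ?_) (by positivity)
            exact mul_le_mul_of_nonneg_left h3 (by positivity)
        _ = n ^ (-ν) := by
            rw [mul_left_comm, ← Real.rpow_add hJ0, neg_add_cancel, Real.rpow_zero, mul_one]
    have hEj : (E j ^ (1 / s)) ^ 2 = E j ^ (2 / s) := by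
      rw [← Real.rpow_natCast, ← Real.rpow_mul (hE0 j)]
      congr 1
      push_cast
      ring
    have hpt : ∀ l ∈ Finset.range K, ((l : ℝ) + 1 / 2) *
      (∑ q ∈ F with q.2 = j ∧ l < q.1, |x q| * (q.1 : ℝ) ^ (2 * (r : ℝ) - 3 / 2)) ^ 2 ≤
        ((J ^ (-μ₂) * C₁) ^ 2 * E j ^ (2 / s)) *
          (((l : ℝ) + 1 / 2) * (max (l : ℝ) m) ^ (-(2 * ν + 2))) := by
      intro l _
      have h1 : 0 ≤ ∑ q ∈ F with q.2 = j ∧ l < q.1,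
          |x q| * (q.1 : ℝ) ^ (2 * (r : ℝ) - 3 / 2) :=
        Finset.sum_nonneg fun q _ => by positivity
      refine (mul_le_mul_of_nonneg_left (pow_le_pow_left₀ h1 (hl l) 2) (by positivity)).trans_eq ?_
      have h2 : ((max (l : ℝ) m) ^ (-(ν + 1))) ^ 2 = (max (l : ℝ) m) ^ (-(2 * ν + 2)) := by
        rw [← Real.rpow_natCast, ← Real.rpow_mul (hm0.le.trans (le_max_right _ _))]
        congr 1
        push_cast
        ring
      rw [mul_pow, mul_pow, mul_pow, h2, hEj]
      ring
    refine (Finset.sum_le_sum hpt).trans ?_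
    rw [← Finset.mul_sum]
    refine (mul_le_mul_of_nonneg_left (sum_add_half_mul_max_rpow_le hν0 K hm2)
      (mul_nonneg (by positivity) (Real.rpow_nonneg (hE0 j) _))).trans ?_
    have h2 : m ^ (-(2 * ν)) = (m ^ (-ν)) ^ 2 := by
      rw [← Real.rpow_natCast, ← Real.rpow_mul hm0.le]
      congr 1
      push_cast
      ring
    have h3 : (J ^ (-μ₂) * m ^ (-ν)) ^ 2 ≤ (n ^ (-ν)) ^ 2 :=
      pow_le_pow_left₀ (by positivity) hJm 2
    rw [h2, ← hC₂]
    calc (J ^ (-μ₂) * C₁) ^ 2 * E j ^ (2 / s) * (C₂ * (m ^ (-ν)) ^ 2)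
        = (C₁ ^ 2 * C₂ * E j ^ (2 / s)) * (J ^ (-μ₂) * m ^ (-ν)) ^ 2 := by ring
      _ ≤ (C₁ ^ 2 * C₂ * E j ^ (2 / s)) * (n ^ (-ν)) ^ 2 :=
          mul_le_mul_of_nonneg_left h3 (mul_nonneg (by positivity) (Real.rpow_nonneg (hE0 j) _))
      _ = _ := by ring
  have hsum : ∑ q ∈ F, d q ^ s = ∑ j ∈ F.image Prod.snd, E j :=
    (Finset.sum_fiberwise_of_maps_to (fun q hq => Finset.mem_image_of_mem _ hq) _).symm
  have hA : 0 ≤ ∑ j ∈ F.image Prod.snd, E j := Finset.sum_nonneg fun j _ => hE0 j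
  refine le_of_sq_le_sq ?_ (by rw [hsum]; positivity)
  refine (norm_sq_sum_legendreL2_le hr F x hKF).trans ?_
  calc _ ≤ (2 ^ (r + 1)) ^ 2 *
        ∑ j ∈ F.image Prod.snd, (C₁ * n ^ (-ν)) ^ 2 * C₂ * E j ^ (2 / s) :=
        mul_le_mul_of_nonneg_left (Finset.sum_le_sum hrowj) (by positivity)
    _ ≤ (2 ^ (r + 1)) ^ 2 * ((C₁ * n ^ (-ν)) ^ 2 * C₂ *
        (∑ j ∈ F.image Prod.snd, E j) ^ (2 / s)) := by
        rw [← Finset.mul_sum]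
        refine mul_le_mul_of_nonneg_left (mul_le_mul_of_nonneg_left ?_ (by positivity))
          (by positivity)
        -- The embedding of `ℓ_s` into `ℓ_2` over the rows: the exponent `2/s` is at least `1`.
        exact sum_rpow_le_rpow_sum _ _ (fun j _ => hE0 j) ((one_le_div hs0).2 hs2.le)
    _ = _ := by
        rw [hsum]
        have h1 : (∑ j ∈ F.image Prod.snd, E j) ^ (2 / s) =
            ((∑ j ∈ F.image Prod.snd, E j) ^ (1 / s)) ^ 2 := by
          rw [← Real.rpow_natCast, ← Real.rpow_mul hA]
          congr 1
          push_cast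
          ring
        have h2 := Real.sq_sqrt hC₂0.le
        rw [h1]
        linear_combination -((2 ^ (r + 1)) ^ 2 * (C₁ * n ^ (-ν)) ^ 2 *
          ((∑ j ∈ F.image Prod.snd, E j) ^ (1 / s)) ^ 2) * h2

theorem summable_max_rpow {γ : ℝ} (hγ : 1 < γ) :
    Summable fun j : ℕ => (max 1 (j : ℝ)) ^ (-γ) := by
  rw [← summable_nat_add_iff 1]
  refine ((summable_nat_add_iff 1).2 (Real.summable_nat_rpow.2 (by linarith : -γ < -1))).congr ?_
  intro j
  rw [max_eq_right]
  simp

/-- A row has at most `m = n / J^γ` entries, so its noise sums to at most `m^{1-1/p} δ`. With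
`k^{2r-3/2} ≤ m^{2r-3/2}` and `∑_{l≤m} (l+1/2)` of order `m²`, the squared norm of the row is of
order `(δ m^e)²`. -/
theorem exists_norm_sum_noise_le {r : ℕ} (hr : 1 ≤ r) {p : ℝ≥0∞} (hp : 1 ≤ p) :
    ∃ C : ℝ, 0 < C ∧ ∀ (γ n δ : ℝ) (F : Finset (ℕ × ℕ)) (ξ : lp (fun _ : ℕ × ℕ => ℝ) p),
      1 ≤ γ → 0 ≤ n → ‖ξ‖ ≤ δ →
      (∀ q ∈ F, 1 ≤ q.1 ∧ q.1 * (max 1 (q.2 : ℝ)) ^ γ ≤ n) →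
      ‖∑ q ∈ F, ξ q • legendreL2 r q‖ ≤
        C * (δ * n ^ (2 * (r : ℝ) + 1 / 2 - (p⁻¹).toReal)) := by
  set S := ∑' j : ℕ, (max 1 (j : ℝ)) ^ (-2 : ℝ) with hSdef
  have hSs := summable_max_rpow (γ := 2) (by norm_num)
  have hS0 : 0 < S := hSs.tsum_pos (fun j => by positivity) 0 (by positivity)
  refine ⟨2 ^ (r + 1) * √(2 * S), by positivity, fun γ n δ F ξ hγ hn hξ hF => ?_⟩
  have hδ : 0 ≤ δ := (lp.norm_nonneg' ξ).trans hξ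
  set P := (p⁻¹).toReal with hP
  have hP1 : P ≤ 1 := by
    have : p⁻¹ ≤ 1 := ENNReal.inv_le_one.2 hp
    exact (ENNReal.toReal_mono ENNReal.one_ne_top this).trans_eq ENNReal.toReal_one
  have hr1 : (1 : ℝ) ≤ r := by exact_mod_cast hr
  set e := 2 * (r : ℝ) + 1 / 2 - P with he
  set K := F.sup Prod.fst with hK
  have hKF : ∀ q ∈ F, q.1 ≤ K := fun q hq => Finset.le_sup (f := Prod.fst) hq
  have hrowj : ∀ j ∈ F.image Prod.snd, ∑ l ∈ Finset.range K, ((l : ℝ) + 1 / 2) *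
      (∑ q ∈ F with q.2 = j ∧ l < q.1, |ξ q| * (q.1 : ℝ) ^ (2 * (r : ℝ) - 3 / 2)) ^ 2 ≤
        (2 * (δ * n ^ e) ^ 2) * (max 1 (j : ℝ)) ^ (-2 : ℝ) := by
    intro j hj
    set J : ℝ := max 1 (j : ℝ) with hJ
    have hJ1 : 1 ≤ J := le_max_left _ _
    have hJ0 : 0 < J := by linarith
    set m : ℝ := n / J ^ γ with hm
    have hqm : ∀ q ∈ F, q.2 = j → (q.1 : ℝ) ≤ m := by
      intro q hq hqj
      have := (hF q hq).2
      rw [hqj] at this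
      rwa [hm, le_div_iff₀ (by positivity)]
    have hm1 : 1 ≤ m := by
      obtain ⟨q, hq, hqj⟩ := Finset.mem_image.1 hj
      have h1 : (1 : ℝ) ≤ q.1 := by exact_mod_cast (hF q hq).1
      exact h1.trans (hqm q hq hqj)
    have hm0 : 0 < m := by linarith
    have hl : ∀ l : ℕ,
        ∑ q ∈ F with q.2 = j ∧ l < q.1, |ξ q| * (q.1 : ℝ) ^ (2 * (r : ℝ) - 3 / 2) ≤
          m ^ (2 * (r : ℝ) - 3 / 2) * (m ^ (1 - P) * δ) := by
      intro l
      set G := F.filter (fun q => q.2 = j ∧ l < q.1) with hG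
      have hGm : ∀ q ∈ G, q.2 = j ∧ 1 ≤ q.1 ∧ (q.1 : ℝ) ≤ m := by
        intro q hq
        obtain ⟨hqF, hqj, hql⟩ := Finset.mem_filter.1 hq
        exact ⟨hqj, (hF q hqF).1, hqm q hqF hqj⟩
      have hcard : (G.card : ℝ) ≤ m := by
        have h1 : G.card ≤ (Finset.Icc 1 ⌊m⌋₊).card := by
          refine Finset.card_le_card_of_injOn Prod.fst ?_ ?_
          · intro q hq
            have := hGm q hq
            exact Finset.mem_coe.2 (Finset.mem_Icc.2 ⟨this.2.1, Nat.le_floor this.2.2⟩)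
          · intro q hq q' hq' heq
            exact Prod.ext heq ((hGm q hq).1.trans (hGm q' hq').1.symm)
        rw [Nat.card_Icc, Nat.add_sub_cancel] at h1
        exact (by exact_mod_cast h1 : (G.card : ℝ) ≤ ⌊m⌋₊).trans (Nat.floor_le hm0.le)
      calc ∑ q ∈ G, |ξ q| * (q.1 : ℝ) ^ (2 * (r : ℝ) - 3 / 2)
          ≤ ∑ q ∈ G, |ξ q| * m ^ (2 * (r : ℝ) - 3 / 2) := by
            refine Finset.sum_le_sum fun q hq => mul_le_mul_of_nonneg_left ?_ (abs_nonneg _)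
            exact Real.rpow_le_rpow (by positivity) (hGm q hq).2.2 (by linarith)
        _ = m ^ (2 * (r : ℝ) - 3 / 2) * ∑ q ∈ G, |ξ q| := by
            rw [← Finset.sum_mul, mul_comm]
        _ ≤ _ := by
            refine mul_le_mul_of_nonneg_left ?_ (by positivity)
            refine (sum_abs_le_card_rpow_mul_norm hp ξ G).trans ?_
            refine mul_le_mul ?_ hξ (lp.norm_nonneg' ξ) (by positivity)
            exact Real.rpow_le_rpow (by positivity) hcard (by linarith)
    have hzero : ∀ l : ℕ, ¬ (l : ℝ) ≤ m →
        ∑ q ∈ F with q.2 = j ∧ l < q.1, |ξ q| * (q.1 : ℝ) ^ (2 * (r : ℝ) - 3 / 2) = 0 := by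
      intro l hlm
      refine Finset.sum_eq_zero fun q hq => absurd ?_ hlm
      obtain ⟨hqF, hqj, hql⟩ := Finset.mem_filter.1 hq
      have h1 : (l : ℝ) ≤ q.1 := by exact_mod_cast hql.le
      exact h1.trans (hqm q hqF hqj)
    rw [← Finset.sum_filter_of_ne (p := fun l : ℕ => (l : ℝ) ≤ m)]
    swap
    · intro l _ hne
      by_contra hlm
      exact hne (by rw [hzero l hlm]; simp)
    have hpt : ∀ l ∈ {l ∈ Finset.range K | ((l : ℕ) : ℝ) ≤ m}, ((l : ℝ) + 1 / 2) *
      (∑ q ∈ F with q.2 = j ∧ l < q.1, |ξ q| * (q.1 : ℝ) ^ (2 * (r : ℝ) - 3 / 2)) ^ 2 ≤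
        ((l : ℝ) + 1 / 2) * (m ^ (2 * (r : ℝ) - 3 / 2) * (m ^ (1 - P) * δ)) ^ 2 := by
      intro l _
      refine mul_le_mul_of_nonneg_left (pow_le_pow_left₀ ?_ (hl l) 2) (by positivity)
      exact Finset.sum_nonneg fun q _ => by positivity
    refine (Finset.sum_le_sum hpt).trans ?_
    rw [← Finset.sum_mul]
    refine (mul_le_mul_of_nonneg_right (sum_add_half_le K hm0.le) (by positivity)).trans ?_
    have h2 : (m + 1) ^ 2 / 2 ≤ 2 * m ^ 2 := by nlinarith
    have h3 : m * (m ^ (2 * (r : ℝ) - 3 / 2) * m ^ (1 - P)) = m ^ e := by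
      nth_rw 1 [← Real.rpow_one m]
      rw [← Real.rpow_add hm0, ← Real.rpow_add hm0]
      congr 1
      rw [he]
      ring
    -- Here `γ ≥ 1` and `e ≥ 1` give `2γe ≥ 2`, so the rows are summable uniformly in `γ`, including
    -- `γ = 1`.
    have h4 : (m ^ e) ^ 2 ≤ (n ^ e) ^ 2 * J ^ (-2 : ℝ) := by
      rw [hm, Real.div_rpow hn (by positivity), div_pow, div_eq_mul_inv]
      refine mul_le_mul_of_nonneg_left ?_ (by positivity)
      rw [← Real.rpow_natCast, ← Real.rpow_mul hJ0.le, ← Real.rpow_mul hJ0.le,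
        ← Real.rpow_neg hJ0.le]
      refine Real.rpow_le_rpow_of_exponent_le hJ1 ?_
      push_cast
      have : 1 ≤ e := by rw [he]; linarith
      nlinarith
    calc (m + 1) ^ 2 / 2 * (m ^ (2 * (r : ℝ) - 3 / 2) * (m ^ (1 - P) * δ)) ^ 2
        ≤ 2 * m ^ 2 * (m ^ (2 * (r : ℝ) - 3 / 2) * (m ^ (1 - P) * δ)) ^ 2 :=
          mul_le_mul_of_nonneg_right h2 (by positivity)
      _ = 2 * δ ^ 2 * (m ^ e) ^ 2 := by rw [← h3]; ring
      _ ≤ 2 * δ ^ 2 * ((n ^ e) ^ 2 * J ^ (-2 : ℝ)) :=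
          mul_le_mul_of_nonneg_left h4 (by positivity)
      _ = _ := by ring
  refine le_of_sq_le_sq ?_ (by positivity)
  refine (norm_sq_sum_legendreL2_le hr F (fun q => ξ q) hKF).trans ?_
  calc _ ≤ (2 ^ (r + 1)) ^ 2 *
        ∑ j ∈ F.image Prod.snd, (2 * (δ * n ^ e) ^ 2) * (max 1 (j : ℝ)) ^ (-2 : ℝ) :=
        mul_le_mul_of_nonneg_left (Finset.sum_le_sum hrowj) (by positivity)
    _ ≤ (2 ^ (r + 1)) ^ 2 * ((2 * (δ * n ^ e) ^ 2) * S) := by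
        rw [← Finset.mul_sum]
        refine mul_le_mul_of_nonneg_left (mul_le_mul_of_nonneg_left ?_ (by positivity))
          (by positivity)
        exact hSs.sum_le_tsum _ fun j _ => by positivity
    _ = _ := by
        have h2 := Real.sq_sqrt (show 0 ≤ 2 * S by positivity)
        linear_combination -((2 ^ (r + 1)) ^ 2 * (δ * n ^ e) ^ 2) * h2

/-! ### The series of the derivative and the truncation method -/

/-- The term `⟨f, φ_{k,j}⟩ φ_k^{(r)}(t) φ_j(τ)` of the series of the derivative, for all `k`. -/
def derivFun (r : ℕ) (f : L2Q) (q : ℕ × ℕ) : L2Q := coeff f q • legendreL2 r q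

theorem legendreL2_eq_zero {r : ℕ} {q : ℕ × ℕ} (h : q.1 < r) : legendreL2 r q = 0 := by
  rw [← Prod.mk.eta (p := q), legendreL2_eq_tensorL2,
    iterate_derivative_eq_zero ((natDegree_legendrePoly_le q.1).trans_lt h), map_zero]

theorem shift_injective (r : ℕ) : Function.Injective fun q : ℕ × ℕ => (r + q.1, q.2) := by
  intro q q' h
  simp only [Prod.mk.injEq, Nat.add_left_cancel_iff] at h
  exact Prod.ext h.1 h.2

theorem support_derivFun_subset (r : ℕ) (f : L2Q) :
    Function.support (derivFun r f) ⊆ Set.range fun q : ℕ × ℕ => (r + q.1, q.2) := by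
  intro q hq
  refine ⟨(q.1 - r, q.2), ?_⟩
  have : r ≤ q.1 := by
    by_contra h
    exact hq (by rw [derivFun, legendreL2_eq_zero (by omega), smul_zero])
  exact Prod.ext (by simp; omega) rfl

theorem summable_derivTerm_iff {r : ℕ} {f : L2Q} :
    Summable (derivTerm r f) ↔ Summable (derivFun r f) :=
  (shift_injective r).summable_iff fun _ hq =>
    Function.notMem_support.1 fun h => hq (support_derivFun_subset r f h)

theorem partialDeriv_eq_tsum (r : ℕ) (f : L2Q) : partialDeriv r f = ∑' q, derivFun r f q :=
  (shift_injective r).tsum_eq (support_derivFun_subset r f)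

theorem weightedNorm_eq {s μ₁ μ₂ : ℝ} (f : L2Q) : weightedNorm s μ₁ μ₂ f =
    (∑' q : ℕ × ℕ, ENNReal.ofReal ((weight μ₁ μ₂ q * |coeff f q|) ^ s)) ^ (1 / s) := by
  unfold weightedNorm
  congr 2
  ext q
  congr 1
  unfold weight
  rw [Real.mul_rpow (by positivity) (abs_nonneg _), Real.mul_rpow (by positivity) (by positivity),
    ← Real.rpow_mul (by positivity), ← Real.rpow_mul (by positivity), mul_comm s, mul_comm s]

theorem weight_mul_abs_rpow_nonneg (s μ₁ μ₂ : ℝ) (x : ℕ × ℕ → ℝ) (q : ℕ × ℕ) :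
    0 ≤ (weight μ₁ μ₂ q * |x q|) ^ s :=
  Real.rpow_nonneg (mul_nonneg (weight_nonneg _ _ _) (abs_nonneg _)) _

theorem summable_of_weightedNorm_lt_top {s μ₁ μ₂ : ℝ} (hs : 1 ≤ s) {f : L2Q}
    (hf : weightedNorm s μ₁ μ₂ f < ⊤) :
    Summable fun q => (weight μ₁ μ₂ q * |coeff f q|) ^ s := by
  rw [weightedNorm_eq, ENNReal.rpow_lt_top_iff_of_pos (by positivity)] at hf
  have := ENNReal.summable_toReal hf.ne
  refine this.congr fun q => ?_
  rw [ENNReal.toReal_ofReal (weight_mul_abs_rpow_nonneg _ _ _ _ _)]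

theorem sum_le_one_of_mem_smoothClass {s μ₁ μ₂ : ℝ} (hs : 1 ≤ s) {f : L2Q}
    (hf : f ∈ smoothClass s μ₁ μ₂) (F : Finset (ℕ × ℕ)) :
    ∑ q ∈ F, (weight μ₁ μ₂ q * |coeff f q|) ^ s ≤ 1 := by
  have h1 : weightedNorm s μ₁ μ₂ f ≤ 1 := hf
  rw [weightedNorm_eq] at h1
  have h2 : ∑' q : ℕ × ℕ, ENNReal.ofReal ((weight μ₁ μ₂ q * |coeff f q|) ^ s) ≤ 1 := by
    have := ENNReal.rpow_le_rpow h1 (show 0 ≤ s by linarith)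
    rwa [← ENNReal.rpow_mul, one_div_mul_cancel (by linarith), ENNReal.rpow_one,
      ENNReal.one_rpow] at this
  have h3 := (ENNReal.sum_le_tsum F).trans h2
  rw [← ENNReal.ofReal_sum_of_nonneg fun q _ => weight_mul_abs_rpow_nonneg _ _ _ _ _] at h3
  rwa [← ENNReal.ofReal_one, ENNReal.ofReal_le_ofReal_iff zero_le_one] at h3

theorem sum_derivFun_eq_filter {r : ℕ} (f : L2Q) (F : Finset (ℕ × ℕ)) :
    ∑ q ∈ F, derivFun r f q = ∑ q ∈ F with r ≤ q.1, coeff f q • legendreL2 r q := by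
  refine (Finset.sum_filter_of_ne fun q _ hne => ?_).symm
  by_contra h
  exact hne (by rw [derivFun, legendreL2_eq_zero (by omega), smul_zero])

/-- Cauchy criterion: with `γ = 0` and `n = 1` the tail estimate bounds any finite partial sum by
its weighted `ℓ_s` norm, which is small off a finite set. -/
theorem summable_derivTerm {r : ℕ} (hr : 1 ≤ r) {s μ₁ μ₂ ν : ℝ} (hs : 1 ≤ s) (hs2 : s < 2)
    (hν : ν = μ₁ - 2 * r + 1 / s - 1 / 2) (hν0 : 0 < ν) (hμ₂ : 0 ≤ μ₂) {f : L2Q}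
    (hf : weightedNorm s μ₁ μ₂ f < ⊤) : Summable (derivTerm r f) := by
  obtain ⟨C, hC, htail⟩ := exists_norm_sum_tail_le hr (μ₂ := μ₂) hs hs2 hν hν0
  rw [summable_derivTerm_iff, summable_iff_vanishing_norm]
  intro ε hε
  have hs0 : 0 < s := by linarith
  obtain ⟨t, ht⟩ := summable_iff_vanishing_norm.1 (summable_of_weightedNorm_lt_top hs hf)
    ((ε / C) ^ s) (by positivity)
  refine ⟨t, fun F hF => ?_⟩
  rw [sum_derivFun_eq_filter]
  refine (htail 0 1 _ (coeff f) (by linarith) one_pos ?_).trans_lt ?_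
  · intro q hq
    have h1 : 1 ≤ q.1 := hr.trans (Finset.mem_filter.1 hq).2
    refine ⟨h1, ?_⟩
    rw [Real.rpow_zero, mul_one]
    exact_mod_cast h1
  · have h1 : ‖∑ q ∈ F with r ≤ q.1, (weight μ₁ μ₂ q * |coeff f q|) ^ s‖ < (ε / C) ^ s :=
      ht _ (Finset.disjoint_of_subset_left (Finset.filter_subset _ _) hF)
    have h0 : 0 ≤ ∑ q ∈ F with r ≤ q.1, (weight μ₁ μ₂ q * |coeff f q|) ^ s :=
      Finset.sum_nonneg fun q _ => weight_mul_abs_rpow_nonneg _ _ _ _ _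
    rw [Real.norm_of_nonneg h0] at h1
    have h2 := Real.rpow_lt_rpow h0 h1 (show 0 < 1 / s by positivity)
    rw [← Real.rpow_mul (by positivity), mul_one_div_cancel hs0.ne', Real.rpow_one,
      lt_div_iff₀ hC] at h2
    rw [Real.one_rpow, mul_one, mul_comm]
    exact h2

theorem weightedNorm_lt_top_of_mem {s μ₁ μ₂ : ℝ} {f : L2Q} (hf : f ∈ smoothClass s μ₁ μ₂) :
    weightedNorm s μ₁ μ₂ f < ⊤ := lt_of_le_of_lt hf ENNReal.one_lt_top

theorem exists_norm_partialDeriv_sub_le {r : ℕ} (hr : 1 ≤ r) {s μ₁ μ₂ ν : ℝ} (hs : 1 ≤ s)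
    (hs2 : s < 2) (hν : ν = μ₁ - 2 * r + 1 / s - 1 / 2) (hν0 : 0 < ν) (hμ₂ : 0 ≤ μ₂) :
    ∃ C : ℝ, 0 < C ∧ ∀ (γ n : ℝ) (Γ : Finset (ℕ × ℕ)), γ * ν ≤ μ₂ → 0 < n →
      (∀ q ∉ Γ, r ≤ q.1 → n ≤ q.1 * (max 1 (q.2 : ℝ)) ^ γ) → ∀ f ∈ smoothClass s μ₁ μ₂,
      ‖partialDeriv r f - ∑ q ∈ Γ, coeff f q • legendreL2 r q‖ ≤ C * n ^ (-ν) := by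
  obtain ⟨C, hC, htail⟩ := exists_norm_sum_tail_le hr (μ₂ := μ₂) hs hs2 hν hν0
  refine ⟨C, hC, fun γ n Γ hγ hn hΓ f hf => ?_⟩
  have hsum : HasSum (derivFun r f) (partialDeriv r f) := by
    rw [partialDeriv_eq_tsum]
    exact (summable_derivTerm_iff.1
      (summable_derivTerm hr hs hs2 hν hν0 hμ₂ (weightedNorm_lt_top_of_mem hf))).hasSum
  refine le_of_tendsto (hsum.sub_const (∑ q ∈ Γ, coeff f q • legendreL2 r q)).norm ?_
  filter_upwards [Filter.eventually_ge_atTop Γ] with F hF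
  have h1 : ∑ q ∈ F, derivFun r f q - ∑ q ∈ Γ, coeff f q • legendreL2 r q =
      ∑ q ∈ F \ Γ, derivFun r f q := by
    rw [← Finset.sum_sdiff hF]
    exact add_sub_cancel_right _ _
  rw [h1, sum_derivFun_eq_filter]
  refine (htail γ n _ (coeff f) hγ hn ?_).trans ?_
  · intro q hq
    obtain ⟨hq1, hq2⟩ := Finset.mem_filter.1 hq
    exact ⟨hr.trans hq2, hΓ q (Finset.mem_sdiff.1 hq1).2 hq2⟩
  · refine mul_le_of_le_one_right (by positivity) ?_
    exact Real.rpow_le_one (Finset.sum_nonneg fun q _ => weight_mul_abs_rpow_nonneg _ _ _ _ _)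
      (sum_le_one_of_mem_smoothClass hs hf _) (by positivity)

/-- Replacing `j` by `max(1,j)` absorbs the box constraints: the row `j = 0`, limited only by `k ≤
n`, has the same length as the row `j = 1`. -/
theorem mem_hypCross_iff {r n : ℕ} (hr : 1 ≤ r) {γ : ℝ} (hγ : 0 < γ) (q : ℕ × ℕ) :
    q ∈ hypCross r n γ ↔ r ≤ q.1 ∧ (q.1 : ℝ) * (max 1 (q.2 : ℝ)) ^ γ ≤ n := by
  rw [hypCross, Finset.mem_filter, Finset.mem_product, Finset.mem_Icc, Finset.mem_range,
    Nat.lt_succ_iff]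
  have hr0 : (0 : ℝ) < r := by exact_mod_cast hr
  constructor
  · rintro ⟨⟨⟨h1, h2⟩, -⟩, h3⟩
    refine ⟨h1, ?_⟩
    rcases Nat.eq_zero_or_pos q.2 with h0 | h0
    · rw [h0, Nat.cast_zero, max_eq_left zero_le_one, Real.one_rpow, mul_one]
      exact_mod_cast h2
    · rwa [max_eq_right (by exact_mod_cast h0)]
  · rintro ⟨h1, h2⟩
    have hk : (r : ℝ) ≤ q.1 := by exact_mod_cast h1
    have hJ : (1 : ℝ) ≤ (max 1 (q.2 : ℝ)) ^ γ := Real.one_le_rpow (le_max_left _ _) hγ.le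
    have hj : (q.2 : ℝ) ^ γ ≤ (max 1 (q.2 : ℝ)) ^ γ :=
      Real.rpow_le_rpow (by positivity) (le_max_right _ _) hγ.le
    refine ⟨⟨⟨h1, ?_⟩, Nat.le_floor ?_⟩, ?_⟩
    · have : (q.1 : ℝ) ≤ n := le_trans (le_mul_of_one_le_right (by positivity) hJ) h2
      exact_mod_cast this
    · have h3 : (q.2 : ℝ) ^ γ ≤ n / r := by
        rw [le_div_iff₀ hr0, mul_comm]
        exact le_trans (mul_le_mul hk hj (by positivity) (by positivity)) h2
      have h4 := Real.rpow_le_rpow (by positivity) h3 (show 0 ≤ 1 / γ by positivity)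
      rwa [← Real.rpow_mul (by positivity), mul_one_div_cancel hγ.ne', Real.rpow_one] at h4
    · exact le_trans (mul_le_mul_of_nonneg_left hj (by positivity)) h2

theorem truncation_eq_sum (r n : ℕ) (γ : ℝ) (y : ℕ × ℕ → ℝ) :
    truncation r n γ (fun q => y q) = ∑ q ∈ hypCross r n γ, y q • legendreL2 r q :=
  Finset.sum_coe_sort (hypCross r n γ) fun q => y q • legendreL2 r q

theorem exists_algError_truncation_le {r : ℕ} (hr : 1 ≤ r) {s μ₁ μ₂ ν : ℝ} (hs : 1 ≤ s)
    (hs2 : s < 2) (hν : ν = μ₁ - 2 * r + 1 / s - 1 / 2) (hν0 : 0 < ν) (hμ₂ : 0 ≤ μ₂)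
    {p : ℝ≥0∞} (hp : 1 ≤ p) :
    ∃ C : ℝ, 0 < C ∧ ∀ (γ δ : ℝ) (n : ℕ), 1 ≤ γ → γ * ν ≤ μ₂ → 1 ≤ n →
      algError r s μ₁ μ₂ p δ (truncation r n γ) ≤ ENNReal.ofReal
        (C * ((n : ℝ) ^ (-ν) + δ * (n : ℝ) ^ (2 * (r : ℝ) + 1 / 2 - (p⁻¹).toReal))) := by
  obtain ⟨C₁, hC₁, h1⟩ := exists_norm_partialDeriv_sub_le hr (μ₂ := μ₂) hs hs2 hν hν0 hμ₂
  obtain ⟨C₂, hC₂, h2⟩ := exists_norm_sum_noise_le hr hp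
  refine ⟨max C₁ C₂, lt_max_of_lt_left hC₁, fun γ δ n hγ hγν hn => ?_⟩
  have hγ0 : 0 < γ := by linarith
  refine iSup₂_le fun f hf => iSup₂_le fun y hy => ENNReal.ofReal_le_ofReal ?_
  obtain ⟨ξ, hξ, hξy⟩ := hy
  have hδ : 0 ≤ δ := (lp.norm_nonneg' ξ).trans hξ
  have e : partialDeriv r f - truncation r n γ (fun q => y q) =
      (partialDeriv r f - ∑ q ∈ hypCross r n γ, coeff f q • legendreL2 r q) +
        ∑ q ∈ hypCross r n γ, ξ q • legendreL2 r q := by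
    rw [truncation_eq_sum]
    have : ∑ q ∈ hypCross r n γ, ξ q • legendreL2 r q =
        ∑ q ∈ hypCross r n γ, coeff f q • legendreL2 r q -
          ∑ q ∈ hypCross r n γ, y q • legendreL2 r q := by
      rw [← Finset.sum_sub_distrib]
      refine Finset.sum_congr rfl fun q _ => ?_
      rw [← hξy, sub_smul]
    rw [this]
    abel
  rw [e, mul_add]
  refine (norm_add_le _ _).trans (add_le_add ?_ ?_)
  · refine (h1 γ n _ hγν (by exact_mod_cast hn) ?_ f hf).trans
      (mul_le_mul_of_nonneg_right (le_max_left _ _) (by positivity))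
    intro q hq hrq
    rw [mem_hypCross_iff hr hγ0, not_and] at hq
    exact (not_le.1 (hq hrq)).le
  · refine (h2 γ n δ _ ξ hγ (by positivity) hξ ?_).trans
      (mul_le_mul_of_nonneg_right (le_max_right _ _) (by positivity))
    intro q hq
    rw [mem_hypCross_iff hr hγ0] at hq
    exact ⟨hr.trans hq.1, hq.2⟩

theorem minimalRadius_le_algError {r : ℕ} {s μ₁ μ₂ : ℝ} {p : ℝ≥0∞} {N : ℕ} {δ : ℝ}
    {Ω : Finset (ℕ × ℕ)} (hΩ : ∀ q ∈ Ω, r ≤ q.1) (hN : Ω.card ≤ N) (ψ : Algorithm Ω) :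
    minimalRadius r s μ₁ μ₂ p N δ ≤ algError r s μ₁ μ₂ p δ ψ :=
  iInf₂_le_of_le Ω ⟨hΩ, hN⟩ (iInf_le _ ψ)

theorem minimalRadius_le_truncation {r : ℕ} (hr : 1 ≤ r) {s μ₁ μ₂ : ℝ} {p : ℝ≥0∞} {N n : ℕ}
    {δ γ : ℝ} (hγ : 0 < γ) (hN : (hypCross r n γ).card ≤ N) :
    minimalRadius r s μ₁ μ₂ p N δ ≤ algError r s μ₁ μ₂ p δ (truncation r n γ) :=
  minimalRadius_le_algError (fun _ hq => ((mem_hypCross_iff hr hγ _).1 hq).1) hN _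

/-- The zero algorithm without information. It covers values of `δ` bounded away from `0`, where no
suitable cross need exist. -/
theorem exists_minimalRadius_le {r : ℕ} (hr : 1 ≤ r) {s μ₁ μ₂ ν : ℝ} (hs : 1 ≤ s)
    (hs2 : s < 2) (hν : ν = μ₁ - 2 * r + 1 / s - 1 / 2) (hν0 : 0 < ν) (hμ₂ : 0 ≤ μ₂)
    (p : ℝ≥0∞) :
    ∃ C : ℝ, 0 < C ∧ ∀ (N : ℕ) (δ : ℝ), minimalRadius r s μ₁ μ₂ p N δ ≤ ENNReal.ofReal C := by
  obtain ⟨C, hC, h1⟩ := exists_norm_partialDeriv_sub_le hr (μ₂ := μ₂) hs hs2 hν hν0 hμ₂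
  refine ⟨C, hC, fun N δ => (minimalRadius_le_algError (Ω := ∅) (by simp) (by simp)
    (fun _ => 0)).trans ?_⟩
  refine iSup₂_le fun f hf => iSup₂_le fun y _ => ENNReal.ofReal_le_ofReal ?_
  have := h1 0 1 ∅ (by linarith) one_pos (fun q _ hq => by
    rw [Real.rpow_zero, mul_one]
    exact_mod_cast hr.trans hq) f hf
  rwa [Finset.sum_empty, Real.one_rpow, mul_one] at this

/-! ### The number of points of the hyperbolic cross -/

/-- Row `j` holds at most `n / max(1,j)^γ` points. The sum over `j` converges for `γ > 1` and is
harmonic for `γ = 1`. -/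
theorem card_hypCross_le_sum {r n : ℕ} (hr : 1 ≤ r) {γ : ℝ} (hγ : 0 < γ) :
    ((hypCross r n γ).card : ℝ) ≤
      n * ∑ j ∈ (hypCross r n γ).image Prod.snd, (max 1 (j : ℝ)) ^ (-γ) := by
  rw [Finset.card_eq_sum_card_fiberwise (f := Prod.snd) (t := (hypCross r n γ).image Prod.snd)
    (fun q hq => Finset.mem_coe.2 (Finset.mem_image_of_mem _ hq)), Finset.mul_sum]
  push_cast
  refine Finset.sum_le_sum fun j _ => ?_
  set J : ℝ := max 1 (j : ℝ) with hJ
  have hJ0 : 0 < J := lt_max_of_lt_left one_pos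
  have h1 : ((hypCross r n γ).filter (fun q => q.2 = j)).card ≤
      (Finset.Icc 1 ⌊n * J ^ (-γ)⌋₊).card := by
    refine Finset.card_le_card_of_injOn Prod.fst ?_ ?_
    · intro q hq
      obtain ⟨hq1, hq2⟩ := Finset.mem_filter.1 hq
      rw [mem_hypCross_iff hr hγ, hq2] at hq1
      refine Finset.mem_coe.2 (Finset.mem_Icc.2 ⟨hr.trans hq1.1, Nat.le_floor ?_⟩)
      rw [Real.rpow_neg hJ0.le, ← div_eq_mul_inv, le_div_iff₀ (by positivity)]
      exact hq1.2
    · intro q hq q' hq' heq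
      exact Prod.ext heq
        ((Finset.mem_filter.1 hq).2.trans (Finset.mem_filter.1 hq').2.symm)
  rw [Nat.card_Icc, Nat.add_sub_cancel] at h1
  exact (by exact_mod_cast h1 : (_ : ℝ) ≤ _).trans (Nat.floor_le (by positivity))

theorem exists_card_hypCross_le {r : ℕ} (hr : 1 ≤ r) {γ : ℝ} (hγ : 1 < γ) :
    ∃ C : ℝ, 0 < C ∧ ∀ n : ℕ, ((hypCross r n γ).card : ℝ) ≤ C * n := by
  have hS := summable_max_rpow hγ
  refine ⟨∑' j : ℕ, (max 1 (j : ℝ)) ^ (-γ), hS.tsum_pos (fun j => by positivity) 0 (by positivity),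
    fun n => (card_hypCross_le_sum hr (by linarith)).trans ?_⟩
  rw [mul_comm]
  exact mul_le_mul_of_nonneg_right (hS.sum_le_tsum _ fun j _ => by positivity) (by positivity)

theorem card_hypCross_one_le {r n : ℕ} (hr : 1 ≤ r) :
    ((hypCross r n 1).card : ℝ) ≤ n * (2 + Real.log n) := by
  refine (card_hypCross_le_sum hr one_pos).trans (mul_le_mul_of_nonneg_left ?_ (by positivity))
  have hsub : (hypCross r n 1).image Prod.snd ⊆ Finset.range (n + 1) := by
    intro j hj
    obtain ⟨q, hq, rfl⟩ := Finset.mem_image.1 hj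
    rw [mem_hypCross_iff hr one_pos, Real.rpow_one] at hq
    have h1 : (1 : ℝ) ≤ q.1 := by exact_mod_cast hr.trans hq.1
    have h2 : (q.2 : ℝ) ≤ n := by
      refine le_trans ?_ hq.2
      exact (le_max_right _ _).trans (le_mul_of_one_le_left (by positivity) h1)
    rw [Finset.mem_range, Nat.lt_succ_iff]
    exact_mod_cast h2
  refine (Finset.sum_le_sum_of_subset_of_nonneg hsub fun j _ _ => by positivity).trans ?_
  rw [Finset.sum_range_succ']
  have h1 : ∑ j ∈ Finset.range n, (max 1 ((j + 1 : ℕ) : ℝ)) ^ (-1 : ℝ) = (harmonic n : ℚ) := by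
    rw [harmonic]
    push_cast
    refine Finset.sum_congr rfl fun j _ => ?_
    rw [max_eq_right (by simp), Real.rpow_neg_one]
  have h2 := harmonic_le_one_add_log n
  rw [h1]
  simp only [Nat.cast_zero, max_eq_left zero_le_one, Real.one_rpow]
  linarith

/-! ### The lower bound -/

theorem coeff_neg (f : L2Q) (q : ℕ × ℕ) : coeff (-f) q = -coeff f q := by
  unfold coeff
  exact inner_neg_left _ _

theorem neg_mem_smoothClass {s μ₁ μ₂ : ℝ} {f : L2Q} (hf : f ∈ smoothClass s μ₁ μ₂) :
    -f ∈ smoothClass s μ₁ μ₂ := by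
  have : weightedNorm s μ₁ μ₂ (-f) = weightedNorm s μ₁ μ₂ f := by
    unfold weightedNorm
    simp only [coeff_neg, abs_neg]
  exact this.trans_le hf

theorem partialDeriv_neg (r : ℕ) (f : L2Q) : partialDeriv r (-f) = -partialDeriv r f := by
  unfold partialDeriv
  rw [← tsum_neg]
  refine tsum_congr fun q => ?_
  rw [derivTerm, derivTerm, coeff_neg, neg_smul]

/-- Both `f` and `-f` with exact data produce the zero vector on `Ω`, hence the same output `ψ 0`,
which cannot be closer than `‖f^{(r,0)}‖` to both derivatives. -/
theorem norm_partialDeriv_le_algError (r : ℕ) {s μ₁ μ₂ δ : ℝ} (p : ℝ≥0∞) (hp : 1 ≤ p)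
    (hδ : 0 ≤ δ) {Ω : Finset (ℕ × ℕ)} (ψ : Algorithm Ω) {f : L2Q} (hf : f ∈ smoothClass s μ₁ μ₂)
    (hΩ : ∀ q ∈ Ω, coeff f q = 0) :
    ENNReal.ofReal ‖partialDeriv r f‖ ≤ algError r s μ₁ μ₂ p δ ψ := by
  have : Fact (1 ≤ p) := ⟨hp⟩
  have hpert : ∀ g : L2Q, IsPerturbation p δ g (coeff g) := fun g =>
    ⟨0, by rw [norm_zero]; exact hδ, fun q => by simp⟩
  have h1 : ENNReal.ofReal ‖partialDeriv r f - ψ 0‖ ≤ algError r s μ₁ μ₂ p δ ψ := by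
    have e : (fun q : Ω => coeff f q) = 0 := funext fun q => hΩ q q.2
    have := le_iSup₂_of_le (f := fun (g : L2Q) (_ : g ∈ smoothClass s μ₁ μ₂) =>
      ⨆ (y : ℕ × ℕ → ℝ) (_ : IsPerturbation p δ g y),
        ENNReal.ofReal ‖partialDeriv r g - ψ (fun q => y q)‖) f hf
      (le_iSup₂_of_le (coeff f) (hpert f) le_rfl)
    rwa [e] at this
  have h2 : ENNReal.ofReal ‖-partialDeriv r f - ψ 0‖ ≤ algError r s μ₁ μ₂ p δ ψ := by
    have e : (fun q : Ω => coeff (-f) q) = 0 := funext fun q => by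
      rw [coeff_neg, hΩ q q.2, neg_zero]
      rfl
    have := le_iSup₂_of_le (f := fun (g : L2Q) (_ : g ∈ smoothClass s μ₁ μ₂) =>
      ⨆ (y : ℕ × ℕ → ℝ) (_ : IsPerturbation p δ g y),
        ENNReal.ofReal ‖partialDeriv r g - ψ (fun q => y q)‖) (-f) (neg_mem_smoothClass hf)
      (le_iSup₂_of_le (coeff (-f)) (hpert (-f)) le_rfl)
    rwa [e, partialDeriv_neg] at this
  have h3 : 2 * ‖partialDeriv r f‖ ≤
      ‖partialDeriv r f - ψ 0‖ + ‖-partialDeriv r f - ψ 0‖ := by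
    have e : (2 : ℝ) • partialDeriv r f =
        (partialDeriv r f - ψ 0) - (-partialDeriv r f - ψ 0) := by
      rw [two_smul]
      abel
    have h4 := norm_sub_le (partialDeriv r f - ψ 0) (-partialDeriv r f - ψ 0)
    rwa [← e, norm_smul, Real.norm_of_nonneg zero_le_two] at h4
  rcases le_total ‖partialDeriv r f - ψ 0‖ ‖-partialDeriv r f - ψ 0‖ with h | h
  · exact (ENNReal.ofReal_le_ofReal (by linarith)).trans h2
  · exact (ENNReal.ofReal_le_ofReal (by linarith)).trans h1

/-- The function `∑_{k ∈ K} t φ_k(t) φ_0(τ)`. -/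
def blockFun (K : Finset ℕ) (t : ℝ) : L2Q := tensorL2 0 (∑ k ∈ K, t • legendrePoly k)

theorem coeff_blockFun (K : Finset ℕ) (t : ℝ) (q : ℕ × ℕ) :
    coeff (blockFun K t) q = if q.1 ∈ K ∧ q.2 = 0 then t else 0 := by
  rw [blockFun, coeff_tensorL2, Finset.sum_mul, map_sum]
  have h1 : ∀ k ∈ K, polyInt (t • legendrePoly k * legendrePoly q.1) =
      if k = q.1 then t else 0 := by
    intro k _
    rw [smul_mul_assoc, map_smul, polyInt_legendrePoly_mul, smul_eq_mul]
    simp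
  rw [Finset.sum_congr rfl h1, Finset.sum_ite_eq']
  by_cases h2 : q.1 ∈ K <;> by_cases h3 : q.2 = 0 <;> simp [h2, h3, eq_comm]

theorem partialDeriv_blockFun (r : ℕ) (K : Finset ℕ) (t : ℝ) :
    partialDeriv r (blockFun K t) =
      tensorL2 0 (∑ k ∈ K, t • derivative^[r] (legendrePoly k)) := by
  rw [partialDeriv_eq_tsum, tsum_eq_sum (s := K ×ˢ {0}), Finset.sum_product, map_sum]
  · refine Finset.sum_congr rfl fun k hk => ?_
    rw [Finset.sum_singleton, derivFun, coeff_blockFun, if_pos ⟨hk, rfl⟩, map_smul]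
    rfl
  · intro q hq
    rw [Finset.mem_product, Finset.mem_singleton] at hq
    rw [derivFun, coeff_blockFun, if_neg hq, zero_smul]

/-- The scaling makes each of the at most `m` nonzero terms of the weighted sum at most `1/m`; the
weight in `j` is `1` because only `j = 0` occurs. -/
theorem blockFun_mem_smoothClass {s μ₁ μ₂ : ℝ} (hs : 1 ≤ s) (hμ₁ : 0 ≤ μ₁) {K : Finset ℕ}
    {D m : ℕ} (hD : 1 ≤ D) (hm : 1 ≤ m) (hKD : ∀ k ∈ K, k ≤ D) (hKm : K.card ≤ m) :
    blockFun K ((D : ℝ) ^ (-μ₁) * (m : ℝ) ^ (-(1 / s))) ∈ smoothClass s μ₁ μ₂ := by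
  have hD0 : (0 : ℝ) < D := by exact_mod_cast hD
  have hm0 : (0 : ℝ) < m := by exact_mod_cast hm
  set t := (D : ℝ) ^ (-μ₁) * (m : ℝ) ^ (-(1 / s)) with ht
  have ht0 : 0 < t := by positivity
  change weightedNorm s μ₁ μ₂ _ ≤ 1
  rw [weightedNorm_eq]
  refine ENNReal.rpow_le_one ?_ (by positivity)
  rw [tsum_eq_sum (s := K ×ˢ {0}), Finset.sum_product]
  · have h1 : ∀ k ∈ K, ∑ j ∈ ({0} : Finset ℕ), ENNReal.ofReal
        ((weight μ₁ μ₂ (k, j) * |coeff (blockFun K t) (k, j)|) ^ s) ≤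
          ENNReal.ofReal ((m : ℝ)⁻¹) := by
      intro k hk
      rw [Finset.sum_singleton, coeff_blockFun, if_pos ⟨hk, rfl⟩, abs_of_pos ht0]
      refine ENNReal.ofReal_le_ofReal ?_
      have h2 : weight μ₁ μ₂ (k, 0) ≤ (D : ℝ) ^ μ₁ := by
        simp only [weight, Nat.cast_zero, max_eq_left zero_le_one, Real.one_rpow, mul_one]
        exact Real.rpow_le_rpow (by positivity)
          (max_le (by exact_mod_cast hD) (by exact_mod_cast hKD k hk)) hμ₁
      have h3 : (D : ℝ) ^ μ₁ * t = (m : ℝ) ^ (-(1 / s)) := by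
        rw [ht, ← mul_assoc, ← Real.rpow_add hD0, add_neg_cancel, Real.rpow_zero, one_mul]
      refine (Real.rpow_le_rpow (mul_nonneg (weight_nonneg _ _ _) ht0.le)
        ((mul_le_mul_of_nonneg_right h2 ht0.le).trans_eq h3) (by linarith)).trans_eq ?_
      rw [← Real.rpow_mul hm0.le, ← Real.rpow_neg_one]
      congr 1
      field_simp
    refine (Finset.sum_le_card_nsmul _ _ _ h1).trans ?_
    rw [nsmul_eq_mul, ← ENNReal.ofReal_natCast, ← ENNReal.ofReal_mul (by positivity)]
    refine (ENNReal.ofReal_le_ofReal ?_).trans_eq ENNReal.ofReal_one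
    rw [← div_eq_mul_inv, div_le_one hm0]
    exact_mod_cast hKm
  · intro q hq
    rw [Finset.mem_product, Finset.mem_singleton] at hq
    rw [coeff_blockFun, if_neg hq, abs_zero, mul_zero, Real.zero_rpow (by linarith),
      ENNReal.ofReal_zero]

theorem eval_one_le_norm_tensorL2 {p : ℝ[X]} {n : ℕ} (hn : 1 ≤ n) (hp : p.degree < n) :
    p.eval 1 / n ≤ ‖tensorL2 0 p‖ := by
  have hn0 : (0 : ℝ) < n := by exact_mod_cast hn
  have h1 : ‖tensorL2 0 p‖ ^ 2 = polyInt (p * p) := by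
    rw [← real_inner_self_eq_norm_sq, inner_tensorL2, if_pos rfl, mul_one]
  have h2 := eval_one_sq_le hp
  rw [← h1] at h2
  rw [div_le_iff₀ hn0]
  refine le_of_sq_le_sq ?_ (by positivity)
  nlinarith [sq_nonneg ((n : ℝ) * ‖tensorL2 0 p‖)]

/-- The endpoint value of the derivative of the block is at least a constant times `M · M^{-μ₁-1/s}
· M^{2r+1/2}`; dividing by the degree bound, of order `M`, leaves `M^{-ν}`. -/
theorem exists_le_algError {r : ℕ} (hr : 1 ≤ r) {s μ₁ μ₂ ν : ℝ} (hs : 1 ≤ s)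
    (hν : ν = μ₁ - 2 * r + 1 / s - 1 / 2) (hμ₁ : 0 ≤ μ₁) {p : ℝ≥0∞} (hp : 1 ≤ p) :
    ∃ c : ℝ, 0 < c ∧ ∀ (Ω : Finset (ℕ × ℕ)) (M : ℕ) (δ : ℝ) (ψ : Algorithm Ω), 1 ≤ M →
      Ω.card ≤ M → 0 ≤ δ →
      ENNReal.ofReal (c * (M : ℝ) ^ (-ν)) ≤ algError r s μ₁ μ₂ p δ ψ := by
  set c₀ : ℝ := (4 ^ r * r.factorial : ℝ)⁻¹ with hc₀
  have hc₀0 : 0 < c₀ := by positivity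
  refine ⟨c₀ * (2 : ℝ) ^ (-(1 / s)) * ((2 * r + 2 : ℝ) ^ (-μ₁) * (2 * r + 2 : ℝ)⁻¹), by positivity,
    fun Ω M δ ψ hM hΩ hδ => ?_⟩
  have hM0 : (0 : ℝ) < M := by exact_mod_cast hM
  set D : ℕ := (2 * r + 2) * M with hD
  have hD1 : 1 ≤ D := Nat.mul_pos (by omega) hM
  -- The block has `2M` degrees, so at least `M` survive the removal of the at most `M` first
  -- coordinates of `Ω`. Starting at `2rM` ensures both `k ≥ 2r` and `k ≥ M`.
  set K : Finset ℕ := Finset.Ico (2 * r * M) D \ Ω.image Prod.fst with hK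
  have hKmem : ∀ k ∈ K, 2 * r * M ≤ k ∧ k < D := fun k hk =>
    Finset.mem_Ico.1 (Finset.mem_sdiff.1 hk).1
  have hIco : (Finset.Ico (2 * r * M) D).card = 2 * M := by
    rw [Nat.card_Ico, hD, add_mul, Nat.add_sub_cancel_left]
  have hKcard : K.card ≤ 2 * M :=
    (Finset.card_le_card Finset.sdiff_subset).trans_eq hIco
  have hKcard' : M ≤ K.card := by
    have h1 := Finset.le_card_sdiff (Ω.image Prod.fst) (Finset.Ico (2 * r * M) D)
    rw [hIco, ← hK] at h1
    have h2 : (Ω.image Prod.fst).card ≤ Ω.card := Finset.card_image_le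
    omega
  set t : ℝ := (D : ℝ) ^ (-μ₁) * ((2 * M : ℕ) : ℝ) ^ (-(1 / s)) with ht
  have ht0 : 0 ≤ t := by positivity
  have hf : blockFun K t ∈ smoothClass s μ₁ μ₂ :=
    blockFun_mem_smoothClass hs hμ₁ hD1 (by omega) (fun k hk => (hKmem k hk).2.le) hKcard
  have hfΩ : ∀ q ∈ Ω, coeff (blockFun K t) q = 0 := by
    intro q hq
    rw [coeff_blockFun, if_neg]
    rintro ⟨h1, -⟩
    exact (Finset.mem_sdiff.1 h1).2 (Finset.mem_image_of_mem _ hq)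
  refine le_trans (ENNReal.ofReal_le_ofReal ?_)
    (norm_partialDeriv_le_algError r p hp hδ ψ hf hfΩ)
  rw [partialDeriv_blockFun]
  have hdeg : (∑ k ∈ K, t • derivative^[r] (legendrePoly k)).degree < (D : WithBot ℕ) := by
    refine (degree_sum_le _ _).trans_lt ?_
    refine (Finset.sup_lt_iff (WithBot.bot_lt_coe D)).2 fun k hk => ?_
    refine (degree_smul_le _ _).trans_lt ?_
    exact (degree_iterate_derivative_legendrePoly_lt hr k).trans
      (WithBot.coe_lt_coe.2 (hKmem k hk).2)
  refine le_trans ?_ (eval_one_le_norm_tensorL2 hD1 hdeg)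
  have hk : ∀ k ∈ K, t * (c₀ * (M : ℝ) ^ (2 * (r : ℝ) + 1 / 2)) ≤
      (t • derivative^[r] (legendrePoly k)).eval 1 := by
    intro k hk
    rw [eval_smul, smul_eq_mul]
    have h1 := (hKmem k hk).1
    have h2 : 2 * r ≤ k := (Nat.le_mul_of_pos_right _ hM).trans h1
    have h3 : M ≤ k := (Nat.le_mul_of_pos_left _ (by omega)).trans h1
    refine mul_le_mul_of_nonneg_left (le_trans ?_
      (le_eval_one_iterate_derivative_legendrePoly (by omega) h2)) ht0
    refine mul_le_mul_of_nonneg_left ?_ hc₀0.le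
    exact Real.rpow_le_rpow hM0.le (by exact_mod_cast h3) (by positivity)
  have hsum : M * (t * (c₀ * (M : ℝ) ^ (2 * (r : ℝ) + 1 / 2))) ≤
      (∑ k ∈ K, t • derivative^[r] (legendrePoly k)).eval 1 := by
    rw [eval_finsetSum]
    refine le_trans ?_ (Finset.card_nsmul_le_sum _ _ _ hk)
    rw [nsmul_eq_mul]
    exact mul_le_mul_of_nonneg_right (by exact_mod_cast hKcard') (by positivity)
  refine le_trans (le_of_eq ?_) (div_le_div_of_nonneg_right hsum (by positivity))
  have hDr : (D : ℝ) = (2 * r + 2 : ℝ) * M := by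
    rw [hD]
    push_cast
    ring
  have h2M : ((2 * M : ℕ) : ℝ) = 2 * (M : ℝ) := by push_cast; ring
  have hpow : (M : ℝ) ^ (-ν) =
      (M : ℝ) ^ (-μ₁) * (M : ℝ) ^ (-(1 / s)) * (M : ℝ) ^ (2 * (r : ℝ) + 1 / 2) := by
    rw [← Real.rpow_add hM0, ← Real.rpow_add hM0]
    congr 1
    rw [hν]
    ring
  rw [ht, h2M, hDr, Real.mul_rpow (by positivity) hM0.le, Real.mul_rpow (by positivity) hM0.le,
    hpow]
  field_simp

theorem exists_le_minimalRadius {r : ℕ} (hr : 1 ≤ r) {s μ₁ μ₂ ν : ℝ} (hs : 1 ≤ s)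
    (hν : ν = μ₁ - 2 * r + 1 / s - 1 / 2) (hμ₁ : 0 ≤ μ₁) {p : ℝ≥0∞} (hp : 1 ≤ p) :
    ∃ c : ℝ, 0 < c ∧ ∀ (N : ℕ) (δ : ℝ), 1 ≤ N → 0 ≤ δ →
      ENNReal.ofReal (c * (N : ℝ) ^ (-ν)) ≤ minimalRadius r s μ₁ μ₂ p N δ := by
  obtain ⟨c, hc, h⟩ := exists_le_algError (μ₂ := μ₂) hr hs hν hμ₁ hp
  exact ⟨c, hc, fun N δ hN hδ => le_iInf₂ fun Ω hΩ => le_iInf fun ψ => h Ω N δ ψ hN hΩ.2 hδ⟩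

/-! ### Balancing the two errors -/

theorem one_le_rpow_neg {a δ : ℝ} (ha : 0 < a) (hδ : 0 < δ) (hδ1 : δ < 1) : 1 ≤ δ ^ (-a) := by
  rw [Real.rpow_neg hδ.le]
  exact (one_le_inv₀ (by positivity)).2 (Real.rpow_le_one hδ.le hδ1.le ha.le)

theorem rpow_neg_rpow_neg {a ν δ : ℝ} (hδ : 0 < δ) : (δ ^ (-a)) ^ (-ν) = δ ^ (a * ν) := by
  rw [← Real.rpow_mul hδ.le, neg_mul_neg]

theorem rpow_le_of_le_mul {ν N B T : ℝ} (hν : 0 ≤ ν) (hN : 0 < N) (hB : 0 < B) (hT : 0 < T)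
    (h : N ≤ B * T) : T ^ (-ν) ≤ B ^ ν * N ^ (-ν) := by
  have h1 := Real.rpow_le_rpow_of_nonpos hN h (neg_nonpos.2 hν)
  rw [Real.mul_rpow hB.le hT.le] at h1
  calc T ^ (-ν) = B ^ ν * (B ^ (-ν) * T ^ (-ν)) := by
        rw [← mul_assoc, ← Real.rpow_add hB, add_neg_cancel, Real.rpow_zero, one_mul]
    _ ≤ B ^ ν * N ^ (-ν) := mul_le_mul_of_nonneg_left h1 (by positivity)

theorem rpow_mul_le_of_le_mul {ν N B T : ℝ} (hν : 0 ≤ ν) (hN : 0 < N) (hB : 0 < B) (hT : 0 < T)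
    (h : N ≤ B * T) : B ^ (-ν) * T ^ (-ν) ≤ N ^ (-ν) := by
  rw [← Real.mul_rpow hB.le hT.le]
  exact Real.rpow_le_rpow_of_nonpos hN h (neg_nonpos.2 hν)

theorem exists_forall_le_rpow_neg {a : ℝ} (ha : 0 < a) (R : ℝ) :
    ∃ δ₀ : ℝ, 0 < δ₀ ∧ δ₀ ≤ 1 / 2 ∧ ∀ δ : ℝ, 0 < δ → δ ≤ δ₀ → R ≤ δ ^ (-a) := by
  set Q : ℝ := max R 1 with hQ
  have hQ0 : 0 < Q := lt_max_of_lt_right one_pos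
  refine ⟨min (1 / 2) (Q ^ (-(1 / a))), by positivity, min_le_left _ _, fun δ hδ hδ' => ?_⟩
  have h1 := Real.rpow_le_rpow_of_nonpos hδ (hδ'.trans (min_le_right _ _))
    (neg_nonpos.2 ha.le)
  rw [← Real.rpow_mul hQ0.le, show -(1 / a) * -a = 1 by field_simp, Real.rpow_one] at h1
  exact (le_max_left _ _).trans h1

theorem exists_forall_le_log (R : ℝ) :
    ∃ δ₀ : ℝ, 0 < δ₀ ∧ δ₀ ≤ 1 / 2 ∧ ∀ δ : ℝ, 0 < δ → δ ≤ δ₀ → R ≤ Real.log (1 / δ) := by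
  refine ⟨min (1 / 2) (Real.exp (-R)), by positivity, min_le_left _ _, fun δ hδ hδ' => ?_⟩
  have h1 := Real.log_le_log hδ (hδ'.trans (min_le_right _ _))
  rw [Real.log_exp] at h1
  rw [one_div, Real.log_inv]
  linarith

theorem log_two_le_log_one_div {δ : ℝ} (hδ : 0 < δ) (hδ' : δ ≤ 1 / 2) :
    Real.log 2 ≤ Real.log (1 / δ) := by
  refine Real.log_le_log two_pos ?_
  rw [le_div_iff₀ hδ]
  linarith

theorem log_rpow_neg {a δ : ℝ} (hδ : 0 < δ) :
    Real.log (δ ^ (-a)) = a * Real.log (1 / δ) := by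
  rw [Real.log_rpow hδ, one_div, Real.log_inv]
  ring

theorem exists_nat_between {x : ℝ} (hx : 1 ≤ x) : ∃ n : ℕ, x / 2 ≤ n ∧ (n : ℝ) ≤ x := by
  refine ⟨⌊x⌋₊, ?_, Nat.floor_le (by linarith)⟩
  have h1 := Nat.lt_floor_add_one x
  have h2 : (1 : ℝ) ≤ ⌊x⌋₊ := by exact_mod_cast Nat.le_floor (by exact_mod_cast hx)
  linarith

/-- The balance is the identity `a (ν + e) = 1`: for `n ≍ δ^{-a}` both `n^{-ν}` and `δ n^e` are of
order `δ^{aν}`. -/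
theorem exists_algError_truncation_le_rpow {r : ℕ} (hr : 1 ≤ r) {s μ₁ μ₂ ν a : ℝ} {p : ℝ≥0∞}
    (hs : 1 ≤ s) (hs2 : s < 2) (hν : ν = μ₁ - 2 * r + 1 / s - 1 / 2) (hν0 : 0 < ν) (hμ₂ : 0 ≤ μ₂)
    (hp : 1 ≤ p) (ha : a = 1 / (μ₁ - (p⁻¹).toReal + 1 / s)) (ha0 : 0 < a)
    {A B : ℝ} (hA : 0 < A) (hB : 0 < B) :
    ∃ C : ℝ, 0 < C ∧ ∀ (γ δ : ℝ) (n : ℕ), 1 ≤ γ → γ * ν ≤ μ₂ → 0 < δ → A * δ ^ (-a) ≤ n →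
      (n : ℝ) ≤ B * δ ^ (-a) →
      algError r s μ₁ μ₂ p δ (truncation r n γ) ≤ ENNReal.ofReal (C * δ ^ (a * ν)) := by
  obtain ⟨C, hC, h⟩ := exists_algError_truncation_le hr hs hs2 hν hν0 hμ₂ hp
  set e := 2 * (r : ℝ) + 1 / 2 - (p⁻¹).toReal with he
  have hr1 : (1 : ℝ) ≤ r := by exact_mod_cast hr
  have he0 : 0 ≤ e := by
    have h1 : p⁻¹ ≤ 1 := ENNReal.inv_le_one.2 hp
    have h2 := (ENNReal.toReal_mono ENNReal.one_ne_top h1).trans_eq ENNReal.toReal_one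
    rw [he]
    linarith
  refine ⟨C * (A ^ (-ν) + B ^ e), by positivity, fun γ δ n hγ hγν hδ hnA hnB => ?_⟩
  have hT : 0 < δ ^ (-a) := by positivity
  have hn0 : (0 : ℝ) < n := lt_of_lt_of_le (by positivity) hnA
  refine (h γ δ n hγ hγν (by exact_mod_cast hn0)).trans (ENNReal.ofReal_le_ofReal ?_)
  rw [mul_assoc, add_mul]
  refine mul_le_mul_of_nonneg_left (add_le_add ?_ ?_) hC.le
  · rw [← rpow_neg_rpow_neg hδ, ← Real.mul_rpow hA.le hT.le]
    exact Real.rpow_le_rpow_of_nonpos (by positivity) hnA (by linarith)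
  · have h1 : (n : ℝ) ^ e ≤ B ^ e * (δ ^ (-a)) ^ e := by
      rw [← Real.mul_rpow hB.le hT.le]
      exact Real.rpow_le_rpow hn0.le hnB he0
    have h2 : δ * (δ ^ (-a)) ^ e = δ ^ (a * ν) := by
      rw [← Real.rpow_mul hδ.le]
      nth_rw 1 [← Real.rpow_one δ]
      rw [← Real.rpow_add hδ]
      congr 1
      have hd : μ₁ - (p⁻¹).toReal + 1 / s ≠ 0 := by
        intro h0
        rw [h0, div_zero] at ha
        exact ha0.ne' ha
      have h3 : a * (μ₁ - (p⁻¹).toReal + 1 / s) = 1 := by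
        rw [ha]
        exact one_div_mul_cancel hd
      rw [he, hν]
      linear_combination -h3
    calc δ * (n : ℝ) ^ e ≤ δ * (B ^ e * (δ ^ (-a)) ^ e) := mul_le_mul_of_nonneg_left h1 hδ.le
      _ = B ^ e * δ ^ (a * ν) := by rw [← h2]; ring

/-- Extends an estimate from small `δ` to all `δ`: above `δ₀` the power `δ^b` is at least `δ₀^b`, so
a constant bound suffices. -/
theorem le_ofReal_mul_rpow_of_le {X : ℝ≥0∞} {δ δ₀ C₀ C₁ b : ℝ} (hb : 0 ≤ b) (hδ : 0 < δ)
    (hδ₀ : 0 < δ₀) (hC₀ : 0 < C₀) (h₀ : X ≤ ENNReal.ofReal C₀)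
    (h₁ : δ ≤ δ₀ → X ≤ ENNReal.ofReal (C₁ * δ ^ b)) :
    X ≤ ENNReal.ofReal (max C₁ (C₀ * δ₀ ^ (-b)) * δ ^ b) := by
  rcases le_or_gt δ δ₀ with h | h
  · exact (h₁ h).trans (ENNReal.ofReal_le_ofReal
      (mul_le_mul_of_nonneg_right (le_max_left _ _) (by positivity)))
  · refine h₀.trans (ENNReal.ofReal_le_ofReal ?_)
    calc C₀ = C₀ * δ₀ ^ (-b) * δ₀ ^ b := by
          rw [mul_assoc, ← Real.rpow_add hδ₀, neg_add_cancel, Real.rpow_zero, mul_one]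
      _ ≤ max C₁ (C₀ * δ₀ ^ (-b)) * δ ^ b :=
          mul_le_mul (le_max_right _ _) (Real.rpow_le_rpow hδ₀.le h.le hb) (by positivity)
            (by positivity)

/-! ### Choice of the hyperbolic cross -/

/-- Take `n` to be the integer part of `(A/C) δ^{-a}`, with `C` from the linear cardinality bound.
Small `δ` makes this number at least `1`, so rounding loses at most a factor `2`. -/
theorem exists_hypCross_card_le {r : ℕ} (hr : 1 ≤ r) {γ a A : ℝ} (hγ : 1 < γ) (ha : 0 < a)
    (hA : 0 < A) :
    ∃ A' B' δ₀ : ℝ, 0 < A' ∧ 0 < B' ∧ 0 < δ₀ ∧ δ₀ < 1 ∧ ∀ δ : ℝ, 0 < δ → δ ≤ δ₀ →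
      ∀ N : ℕ, A * δ ^ (-a) ≤ N → ∃ n : ℕ, A' * δ ^ (-a) ≤ n ∧ (n : ℝ) ≤ B' * δ ^ (-a) ∧
        (hypCross r n γ).card ≤ N := by
  obtain ⟨C, hC, hcard⟩ := exists_card_hypCross_le hr hγ
  obtain ⟨δ₀, hδ₀, hδ₀', hT⟩ := exists_forall_le_rpow_neg ha (C / A)
  refine ⟨A / C / 2, A / C, δ₀, by positivity, by positivity, hδ₀, by linarith,
    fun δ hδ hδ' N hN => ?_⟩
  have h1 : 1 ≤ A / C * δ ^ (-a) := by
    have := mul_le_mul_of_nonneg_left (hT δ hδ hδ') (show 0 ≤ A / C by positivity)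
    rwa [div_mul_div_cancel₀ hC.ne', div_self hA.ne'] at this
  obtain ⟨n, hn1, hn2⟩ := exists_nat_between h1
  refine ⟨n, by linarith, hn2, ?_⟩
  have h2 : ((hypCross r n γ).card : ℝ) ≤ N := by
    refine (hcard n).trans (le_trans ?_ hN)
    refine (mul_le_mul_of_nonneg_left hn2 hC.le).trans_eq ?_
    field_simp
  exact_mod_cast h2

theorem card_hypCross_one_le_log {r n : ℕ} (hr : 1 ≤ r) {a B δ : ℝ} (hB : 0 < B)
    (hδ : 0 < δ) (hδ' : δ ≤ 1 / 2) (hn : 1 ≤ n) (hnB : (n : ℝ) ≤ B * δ ^ (-a)) {b : ℝ}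
    (hb : Real.log B ≤ b) (hb0 : 0 ≤ b) :
    ((hypCross r n 1).card : ℝ) ≤
      B * ((2 + b) / Real.log 2 + a) * (δ ^ (-a) * Real.log (1 / δ)) := by
  have hT : 0 < δ ^ (-a) := by positivity
  have hL := log_two_le_log_one_div hδ hδ'
  have hl2 : 0 < Real.log 2 := Real.log_pos one_lt_two
  have hn1 : (1 : ℝ) ≤ n := by exact_mod_cast hn
  have h1 : Real.log n ≤ b + a * Real.log (1 / δ) := by
    have := Real.log_le_log (by linarith) hnB
    rw [Real.log_mul hB.ne' hT.ne', log_rpow_neg hδ] at this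
    linarith
  have h2 : 2 + b ≤ (2 + b) / Real.log 2 * Real.log (1 / δ) := by
    have := mul_le_mul_of_nonneg_left hL (show 0 ≤ (2 + b) / Real.log 2 by positivity)
    rwa [div_mul_cancel₀ _ hl2.ne'] at this
  calc ((hypCross r n 1).card : ℝ) ≤ n * (2 + Real.log n) := card_hypCross_one_le hr
    _ ≤ B * δ ^ (-a) * (((2 + b) / Real.log 2 + a) * Real.log (1 / δ)) := by
        refine mul_le_mul hnB (by linarith) ?_ (by positivity)
        have := Real.log_nonneg hn1
        linarith
    _ = _ := by ring

theorem exists_hypCross_one_card_le {r : ℕ} (hr : 1 ≤ r) {a A : ℝ} (ha : 0 < a) (hA : 0 < A) :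
    ∃ A' B' δ₀ : ℝ, 0 < A' ∧ 0 < B' ∧ 0 < δ₀ ∧ δ₀ ≤ 1 / 2 ∧ ∀ δ : ℝ, 0 < δ → δ ≤ δ₀ →
      ∀ N : ℕ, A * (δ ^ (-a) * Real.log (1 / δ)) ≤ N →
        ∃ n : ℕ, A' * δ ^ (-a) ≤ n ∧ (n : ℝ) ≤ B' * δ ^ (-a) ∧ (hypCross r n 1).card ≤ N := by
  have hl2 : 0 < Real.log 2 := Real.log_pos one_lt_two
  set Q : ℝ := 2 / Real.log 2 + a with hQ
  have hQ0 : 0 < Q := by positivity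
  -- With `n ≤ η δ^{-a}`, the bound `η ≤ 1` removes `log η` from the estimate of `log n`, and `ηQ ≤
  -- A` makes the cross fit into `N` points.
  set η : ℝ := min 1 (A / Q) with hη
  have hη0 : 0 < η := lt_min one_pos (by positivity)
  obtain ⟨δ₀, hδ₀, hδ₀', hT⟩ := exists_forall_le_rpow_neg ha (1 / η)
  refine ⟨η / 2, η, δ₀, by positivity, hη0, hδ₀, hδ₀', fun δ hδ hδ' N hN => ?_⟩
  have h1 : 1 ≤ η * δ ^ (-a) := by
    have := mul_le_mul_of_nonneg_left (hT δ hδ hδ') hη0.le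
    rwa [mul_one_div_cancel hη0.ne'] at this
  obtain ⟨n, hn1, hn2⟩ := exists_nat_between h1
  have hn0 : (0 : ℝ) < n := lt_of_lt_of_le (by linarith) hn1
  refine ⟨n, by linarith, hn2, ?_⟩
  have h2 : ((hypCross r n 1).card : ℝ) ≤ N := by
    refine (card_hypCross_one_le_log hr hη0 hδ (hδ'.trans hδ₀') (by exact_mod_cast hn0) hn2
      (b := 0) (Real.log_nonpos hη0.le (min_le_left _ _)) le_rfl).trans (le_trans ?_ hN)
    have hL := log_two_le_log_one_div hδ (hδ'.trans hδ₀')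
    refine mul_le_mul_of_nonneg_right ?_ (mul_nonneg (by positivity) (by linarith))
    rw [add_zero, ← hQ]
    exact (mul_le_mul_of_nonneg_right (min_le_right _ _) hQ0.le).trans_eq
      (div_mul_cancel₀ _ hQ0.ne')
  exact_mod_cast h2

/-- If `A log(1/δ) ≥ 1`, then `N ≥ δ^{-a}` and so `log N ≥ a log(1/δ)`, which cancels the logarithm
in the upper bound for `N`. Otherwise `log(1/δ)` is bounded by `1/A`, and `log N ≥ log 2` suffices.
-/
theorem div_log_le {a A B δ N : ℝ} (ha : 0 < a) (hA : 0 < A) (hB : 0 < B) (hδ : 0 < δ)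
    (hδ1 : δ < 1) (hN2 : 2 ≤ N) (hNA : A * (δ ^ (-a) * Real.log (1 / δ)) ≤ N)
    (hNB : N ≤ B * (δ ^ (-a) * Real.log (1 / δ))) :
    N / Real.log N ≤ max (B / a) (B / (A * Real.log 2)) * δ ^ (-a) := by
  have hT : 0 < δ ^ (-a) := by positivity
  have hl2 : 0 < Real.log 2 := Real.log_pos one_lt_two
  have hL : 0 < Real.log (1 / δ) := Real.log_pos (by rw [lt_div_iff₀ hδ]; linarith)
  have hlN : Real.log 2 ≤ Real.log N := Real.log_le_log two_pos hN2
  have hlN0 : 0 < Real.log N := by linarith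
  rw [div_le_iff₀ hlN0]
  refine hNB.trans ?_
  rcases le_or_gt 1 (A * Real.log (1 / δ)) with h | h
  · have h1 : δ ^ (-a) ≤ N := by
      refine le_trans ?_ hNA
      rw [mul_left_comm]
      exact le_mul_of_one_le_right hT.le h
    have h2 := Real.log_le_log hT h1
    rw [log_rpow_neg hδ] at h2
    calc B * (δ ^ (-a) * Real.log (1 / δ)) = B / a * δ ^ (-a) * (a * Real.log (1 / δ)) := by
          field_simp
      _ ≤ max (B / a) (B / (A * Real.log 2)) * δ ^ (-a) * Real.log N :=
          mul_le_mul (mul_le_mul_of_nonneg_right (le_max_left _ _) hT.le) h2 (by positivity)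
            (by positivity)
  · have h1 : Real.log (1 / δ) ≤ 1 / A := by
      rw [le_div_iff₀ hA]
      linarith
    calc B * (δ ^ (-a) * Real.log (1 / δ)) ≤ B * (δ ^ (-a) * (1 / A)) := by gcongr
      _ = B / (A * Real.log 2) * δ ^ (-a) * Real.log 2 := by field_simp
      _ ≤ max (B / a) (B / (A * Real.log 2)) * δ ^ (-a) * Real.log N :=
          mul_le_mul (mul_le_mul_of_nonneg_right (le_max_right _ _) hT.le) hlN hl2.le
            (by positivity)

theorem rpow_le_div_log_rpow {a ν A B δ N : ℝ} (ha : 0 < a) (hν : 0 ≤ ν) (hA : 0 < A) (hB : 0 < B)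
    (hδ : 0 < δ) (hδ1 : δ < 1) (hN2 : 2 ≤ N) (hNA : A * (δ ^ (-a) * Real.log (1 / δ)) ≤ N)
    (hNB : N ≤ B * (δ ^ (-a) * Real.log (1 / δ))) :
    δ ^ (a * ν) ≤
      max (B / a) (B / (A * Real.log 2)) ^ ν * (N / Real.log N) ^ (-ν) := by
  rw [← rpow_neg_rpow_neg hδ]
  exact rpow_le_of_le_mul hν (div_pos (by linarith) (Real.log_pos (by linarith)))
    (lt_max_of_lt_left (by positivity)) (by positivity)
    (div_log_le ha hA hB hδ hδ1 hN2 hNA hNB)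

end

end GalerkinRadius

/-! ### Assembly of the theorem -/

theorem mainTheorem3 (r : ℕ) (hr : 1 ≤ r) (s μ₁ μ₂ : ℝ) (p : ℝ≥0∞)
    (hs : 1 ≤ s) (hs2 : s < 2) (hp : 1 ≤ p)
    (ν a : ℝ) (hν : ν = μ₁ - 2 * r + 1 / s - 1 / 2) (ha : a = 1 / (μ₁ - (p⁻¹).toReal + 1 / s))
    (hμ₁ : 2 * r - 1 / s + 1 / 2 < μ₁) (hμ₂ : μ₁ - 2 * r + 1 / s - 1 / 2 ≤ μ₂) :
    -- the series of the derivative converges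
    (∀ f : GalerkinRadius.L2Q, GalerkinRadius.weightedNorm s μ₁ μ₂ f < ⊤ →
      Summable (GalerkinRadius.derivTerm r f)) ∧
    -- (a) the minimal radius
    (∀ A B : ℝ, 0 < A → 0 < B → ∃ c C : ℝ, 0 < c ∧ 0 < C ∧
      ∀ δ : ℝ, 0 < δ → δ < 1 → ∀ N : ℕ, A * δ ^ (-a) ≤ N → (N : ℝ) ≤ B * δ ^ (-a) →
        ENNReal.ofReal (c * (N : ℝ) ^ (-ν)) ≤ GalerkinRadius.minimalRadius r s μ₁ μ₂ p N δ ∧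
        ENNReal.ofReal (c * δ ^ (a * ν)) ≤ GalerkinRadius.minimalRadius r s μ₁ μ₂ p N δ ∧
        (ν < μ₂ →
          GalerkinRadius.minimalRadius r s μ₁ μ₂ p N δ ≤ ENNReal.ofReal (C * (N : ℝ) ^ (-ν)) ∧
          GalerkinRadius.minimalRadius r s μ₁ μ₂ p N δ ≤ ENNReal.ofReal (C * δ ^ (a * ν)))) ∧
    -- (a) the order is attained by the truncation method
    (∀ γ : ℝ, 1 < γ → γ ≤ μ₂ / ν → ∀ A B : ℝ, 0 < A → 0 < B →
      (∃ c C : ℝ, 0 < c ∧ 0 < C ∧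
        ∀ δ : ℝ, 0 < δ → δ < 1 → ∀ n : ℕ, A * δ ^ (-a) ≤ n → (n : ℝ) ≤ B * δ ^ (-a) →
          ((GalerkinRadius.hypCross r n γ).card : ℝ) ≤ C * δ ^ (-a) ∧
          ENNReal.ofReal (c * δ ^ (a * ν)) ≤
            GalerkinRadius.algError r s μ₁ μ₂ p δ (GalerkinRadius.truncation r n γ) ∧
          GalerkinRadius.algError r s μ₁ μ₂ p δ (GalerkinRadius.truncation r n γ) ≤
            ENNReal.ofReal (C * δ ^ (a * ν))) ∧
      (∃ A' B' C δ₀ : ℝ, 0 < A' ∧ 0 < B' ∧ 0 < C ∧ 0 < δ₀ ∧ δ₀ < 1 ∧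
        ∀ δ : ℝ, 0 < δ → δ ≤ δ₀ → ∀ N : ℕ, A * δ ^ (-a) ≤ N → (N : ℝ) ≤ B * δ ^ (-a) →
          ∃ n : ℕ, A' * δ ^ (-a) ≤ n ∧ (n : ℝ) ≤ B' * δ ^ (-a) ∧
            (GalerkinRadius.hypCross r n γ).card ≤ N ∧
            GalerkinRadius.algError r s μ₁ μ₂ p δ (GalerkinRadius.truncation r n γ) ≤
              ENNReal.ofReal (C * (N : ℝ) ^ (-ν)))) ∧
    -- (b) the minimal radius
    (∀ A B : ℝ, 0 < A → 0 < B → ∃ c C : ℝ, 0 < c ∧ 0 < C ∧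
      ∀ δ : ℝ, 0 < δ → δ < 1 → ∀ N : ℕ, 2 ≤ N →
        A * (δ ^ (-a) * Real.log (1 / δ)) ≤ N → (N : ℝ) ≤ B * (δ ^ (-a) * Real.log (1 / δ)) →
        ENNReal.ofReal (c * (N : ℝ) ^ (-ν)) ≤ GalerkinRadius.minimalRadius r s μ₁ μ₂ p N δ ∧
        GalerkinRadius.minimalRadius r s μ₁ μ₂ p N δ ≤
          ENNReal.ofReal (C * ((N : ℝ) / Real.log N) ^ (-ν)) ∧
        ENNReal.ofReal (c * (δ ^ (a * ν) * Real.log (1 / δ) ^ (-ν))) ≤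
          GalerkinRadius.minimalRadius r s μ₁ μ₂ p N δ ∧
        GalerkinRadius.minimalRadius r s μ₁ μ₂ p N δ ≤ ENNReal.ofReal (C * δ ^ (a * ν))) ∧
    -- (b) the upper bounds are attained by the truncation method with parameter 1
    (∀ A B : ℝ, 0 < A → 0 < B →
      (∃ C : ℝ, 0 < C ∧
        ∀ δ : ℝ, 0 < δ → δ < 1 → ∀ n : ℕ, A * δ ^ (-a) ≤ n → (n : ℝ) ≤ B * δ ^ (-a) →
          (δ ≤ 1 / 2 → ((GalerkinRadius.hypCross r n 1).card : ℝ) ≤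
            C * (δ ^ (-a) * Real.log (1 / δ))) ∧
          GalerkinRadius.algError r s μ₁ μ₂ p δ (GalerkinRadius.truncation r n 1) ≤
            ENNReal.ofReal (C * δ ^ (a * ν))) ∧
      (∃ A' B' C δ₀ : ℝ, 0 < A' ∧ 0 < B' ∧ 0 < C ∧ 0 < δ₀ ∧ δ₀ < 1 ∧
        ∀ δ : ℝ, 0 < δ → δ ≤ δ₀ → ∀ N : ℕ,
          A * (δ ^ (-a) * Real.log (1 / δ)) ≤ N → (N : ℝ) ≤ B * (δ ^ (-a) * Real.log (1 / δ)) →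
          ∃ n : ℕ, A' * δ ^ (-a) ≤ n ∧ (n : ℝ) ≤ B' * δ ^ (-a) ∧
            (GalerkinRadius.hypCross r n 1).card ≤ N ∧
            GalerkinRadius.algError r s μ₁ μ₂ p δ (GalerkinRadius.truncation r n 1) ≤
              ENNReal.ofReal (C * ((N : ℝ) / Real.log N) ^ (-ν)) ∧
            GalerkinRadius.algError r s μ₁ μ₂ p δ (GalerkinRadius.truncation r n 1) ≤
              ENNReal.ofReal (C * δ ^ (a * ν)))) := by
  have hs0 : 0 < s := by linarith
  have hν0 : 0 < ν := by rw [hν]; linarith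
  have hr1 : (1 : ℝ) ≤ r := by exact_mod_cast hr
  have hsle : 1 / s ≤ 1 := by
    rw [div_le_one hs0]
    exact hs
  have hμ₁0 : 0 ≤ μ₁ := by linarith
  have hνμ₂ : ν ≤ μ₂ := by rw [hν]; exact hμ₂
  have hμ₂0 : 0 ≤ μ₂ := by linarith
  have ha0 : 0 < a := by
    have h1 : p⁻¹ ≤ 1 := ENNReal.inv_le_one.2 hp
    have h2 := (ENNReal.toReal_mono ENNReal.one_ne_top h1).trans_eq ENNReal.toReal_one
    rw [ha]
    exact one_div_pos.2 (by linarith)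
  have haν : 0 ≤ a * ν := by positivity
  obtain ⟨c, hc, hlow⟩ := GalerkinRadius.exists_le_algError (μ₂ := μ₂) hr hs hν hμ₁0 hp
  obtain ⟨c₁, hc₁, hlowR⟩ := GalerkinRadius.exists_le_minimalRadius (μ₂ := μ₂) hr hs hν hμ₁0 hp
  obtain ⟨C₀, hC₀, htriv⟩ := GalerkinRadius.exists_minimalRadius_le hr hs hs2 hν hν0 hμ₂0 p
  have hup := fun {A B : ℝ} (hA : 0 < A) (hB : 0 < B) =>
    GalerkinRadius.exists_algError_truncation_le_rpow hr hs hs2 hν hν0 hμ₂0 hp ha ha0 hA hB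
  have hγ1 : (1 : ℝ) * ν ≤ μ₂ := by rw [one_mul]; exact hνμ₂
  refine ⟨fun f hf => GalerkinRadius.summable_derivTerm hr hs hs2 hν hν0 hμ₂0 hf,
    fun A B hA hB => ?_, fun γ hγ hγν A B hA hB => ⟨?_, ?_⟩, fun A B hA hB => ?_,
    fun A B hA hB => ⟨?_, ?_⟩⟩
  · have hupper : ∃ C : ℝ, 0 < C ∧ ∀ δ : ℝ, 0 < δ → ∀ N : ℕ, A * δ ^ (-a) ≤ N →
        ν < μ₂ → GalerkinRadius.minimalRadius r s μ₁ μ₂ p N δ ≤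
          ENNReal.ofReal (C * δ ^ (a * ν)) := by
      by_cases hlt : ν < μ₂
      -- The largest admissible parameter `γ = μ₂/ν` is used, so that the constants depend on the
      -- smoothness parameters only.
      · have hγ : 1 < μ₂ / ν := (one_lt_div hν0).2 hlt
        obtain ⟨A', B', δ₀, hA', hB', hδ₀, -, h⟩ :=
          GalerkinRadius.exists_hypCross_card_le hr hγ ha0 hA
        obtain ⟨C, hC, hC'⟩ := hup hA' hB'
        refine ⟨max C (C₀ * δ₀ ^ (-(a * ν))), lt_max_of_lt_left hC, fun δ hδ N hN _ => ?_⟩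
        refine GalerkinRadius.le_ofReal_mul_rpow_of_le haν hδ hδ₀ hC₀ (htriv N δ) fun hδ' => ?_
        obtain ⟨n, hn1, hn2, hn3⟩ := h δ hδ hδ' N hN
        exact (GalerkinRadius.minimalRadius_le_truncation hr (by linarith) hn3).trans
          (hC' _ δ n hγ.le (div_mul_cancel₀ _ hν0.ne').le hδ hn1 hn2)
      · exact ⟨1, one_pos, fun δ _ N _ h => absurd h hlt⟩
    obtain ⟨C, hC, hupper⟩ := hupper
    refine ⟨min c₁ (c₁ * B ^ (-ν)), max C (C * B ^ ν), lt_min hc₁ (by positivity),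
      lt_max_of_lt_left hC, fun δ hδ hδ1 N hNA hNB => ?_⟩
    have hT : 0 < δ ^ (-a) := by positivity
    have hN0 : (0 : ℝ) < N := lt_of_lt_of_le (by positivity) hNA
    have hN1 : 1 ≤ N := by exact_mod_cast hN0
    refine ⟨?_, ?_, fun hlt => ⟨?_, ?_⟩⟩
    · refine (ENNReal.ofReal_le_ofReal ?_).trans (hlowR N δ hN1 hδ.le)
      exact mul_le_mul_of_nonneg_right (min_le_left _ _) (by positivity)
    · refine (ENNReal.ofReal_le_ofReal ?_).trans (hlowR N δ hN1 hδ.le)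
      have h1 := GalerkinRadius.rpow_mul_le_of_le_mul hν0.le hN0 hB hT hNB
      rw [GalerkinRadius.rpow_neg_rpow_neg hδ] at h1
      calc min c₁ (c₁ * B ^ (-ν)) * δ ^ (a * ν) ≤ c₁ * B ^ (-ν) * δ ^ (a * ν) :=
            mul_le_mul_of_nonneg_right (min_le_right _ _) (by positivity)
        _ = c₁ * (B ^ (-ν) * δ ^ (a * ν)) := mul_assoc _ _ _
        _ ≤ c₁ * (N : ℝ) ^ (-ν) := mul_le_mul_of_nonneg_left h1 hc₁.le
    · refine (hupper δ hδ N hNA hlt).trans (ENNReal.ofReal_le_ofReal ?_)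
      have h1 := GalerkinRadius.rpow_le_of_le_mul hν0.le hN0 hB hT hNB
      rw [GalerkinRadius.rpow_neg_rpow_neg hδ] at h1
      calc C * δ ^ (a * ν) ≤ C * (B ^ ν * (N : ℝ) ^ (-ν)) := mul_le_mul_of_nonneg_left h1 hC.le
        _ = C * B ^ ν * (N : ℝ) ^ (-ν) := (mul_assoc _ _ _).symm
        _ ≤ _ := mul_le_mul_of_nonneg_right (le_max_right _ _) (by positivity)
    · refine (hupper δ hδ N hNA hlt).trans (ENNReal.ofReal_le_ofReal ?_)
      exact mul_le_mul_of_nonneg_right (le_max_left _ _) (by positivity)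
  · have hγν' : γ * ν ≤ μ₂ := (le_div_iff₀ hν0).1 hγν
    obtain ⟨C, hC, hC'⟩ := hup hA hB
    obtain ⟨C₁, hC₁, hcard⟩ := GalerkinRadius.exists_card_hypCross_le hr hγ
    refine ⟨c * (C₁ * B + 1) ^ (-ν), max C (C₁ * B), by positivity, lt_max_of_lt_left hC,
      fun δ hδ hδ1 n hnA hnB => ?_⟩
    have hT : 0 < δ ^ (-a) := by positivity
    have hT1 := GalerkinRadius.one_le_rpow_neg ha0 hδ hδ1
    have hcard' : ((GalerkinRadius.hypCross r n γ).card : ℝ) ≤ C₁ * B * δ ^ (-a) := by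
      refine (hcard n).trans ((mul_le_mul_of_nonneg_left hnB hC₁.le).trans_eq ?_)
      exact (mul_assoc _ _ _).symm
    refine ⟨hcard'.trans (mul_le_mul_of_nonneg_right (le_max_right _ _) hT.le), ?_,
      (hC' γ δ n hγ.le hγν' hδ hnA hnB).trans (ENNReal.ofReal_le_ofReal
        (mul_le_mul_of_nonneg_right (le_max_left _ _) (by positivity)))⟩
    have hM0 : 0 < C₁ * B * δ ^ (-a) := by positivity
    -- The cross may be empty, so the lower bound is applied with this positive majorant of its
    -- cardinality; `δ^{-a} ≥ 1` absorbs the rounding, whence the `+ 1` in the constant.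
    have hM1 : 1 ≤ ⌈C₁ * B * δ ^ (-a)⌉₊ := Nat.ceil_pos.2 hM0
    refine (ENNReal.ofReal_le_ofReal ?_).trans
      (hlow _ ⌈C₁ * B * δ ^ (-a)⌉₊ δ (GalerkinRadius.truncation r n γ) hM1 ?_ hδ.le)
    · rw [mul_assoc, ← GalerkinRadius.rpow_neg_rpow_neg hδ]
      refine mul_le_mul_of_nonneg_left ?_ hc.le
      refine GalerkinRadius.rpow_mul_le_of_le_mul hν0.le (by exact_mod_cast hM1) (by positivity)
        hT ?_
      have := (Nat.ceil_lt_add_one hM0.le).le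
      linarith
    · exact_mod_cast hcard'.trans (Nat.le_ceil _)
  · have hγν' : γ * ν ≤ μ₂ := (le_div_iff₀ hν0).1 hγν
    obtain ⟨A', B', δ₀, hA', hB', hδ₀, hδ₀1, h⟩ :=
      GalerkinRadius.exists_hypCross_card_le hr hγ ha0 hA
    obtain ⟨C, hC, hC'⟩ := hup hA' hB'
    refine ⟨A', B', C * B ^ ν, δ₀, hA', hB', by positivity, hδ₀, hδ₀1,
      fun δ hδ hδ' N hNA hNB => ?_⟩
    obtain ⟨n, hn1, hn2, hn3⟩ := h δ hδ hδ' N hNA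
    refine ⟨n, hn1, hn2, hn3, (hC' γ δ n hγ.le hγν' hδ hn1 hn2).trans
      (ENNReal.ofReal_le_ofReal ?_)⟩
    have hT : 0 < δ ^ (-a) := by positivity
    have h1 := GalerkinRadius.rpow_le_of_le_mul hν0.le (lt_of_lt_of_le (by positivity) hNA) hB hT
      hNB
    rw [GalerkinRadius.rpow_neg_rpow_neg hδ] at h1
    rw [mul_assoc]
    exact mul_le_mul_of_nonneg_left h1 hC.le
  · obtain ⟨A', B', δ₀, hA', hB', hδ₀, -, h⟩ :=
      GalerkinRadius.exists_hypCross_one_card_le hr ha0 hA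
    obtain ⟨C, hC, hC'⟩ := hup hA' hB'
    set C₁ : ℝ := max C (C₀ * δ₀ ^ (-(a * ν))) with hC₁
    have hC₁0 : 0 < C₁ := lt_max_of_lt_left hC
    set Q : ℝ := max (B / a) (B / (A * Real.log 2)) ^ ν with hQ
    refine ⟨min c₁ (c₁ * B ^ (-ν)), max C₁ (C₁ * Q), lt_min hc₁ (by positivity),
      lt_max_of_lt_left hC₁0, fun δ hδ hδ1 N hN2 hNA hNB => ?_⟩
    have hT : 0 < δ ^ (-a) := by positivity
    have hL : 0 < Real.log (1 / δ) := Real.log_pos (by rw [lt_div_iff₀ hδ]; linarith)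
    have hN2' : (2 : ℝ) ≤ N := by exact_mod_cast hN2
    have hN0 : (0 : ℝ) < N := by linarith
    have hlN : 0 < Real.log N := Real.log_pos (by linarith)
    have hupper : GalerkinRadius.minimalRadius r s μ₁ μ₂ p N δ ≤
        ENNReal.ofReal (C₁ * δ ^ (a * ν)) := by
      refine GalerkinRadius.le_ofReal_mul_rpow_of_le haν hδ hδ₀ hC₀ (htriv N δ) fun hδ' => ?_
      obtain ⟨n, hn1, hn2, hn3⟩ := h δ hδ hδ' N hNA
      exact (GalerkinRadius.minimalRadius_le_truncation hr one_pos hn3).trans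
        (hC' 1 δ n le_rfl hγ1 hδ hn1 hn2)
    refine ⟨?_, ?_, ?_, ?_⟩
    · refine (ENNReal.ofReal_le_ofReal ?_).trans (hlowR N δ (by omega) hδ.le)
      exact mul_le_mul_of_nonneg_right (min_le_left _ _) (by positivity)
    · refine hupper.trans (ENNReal.ofReal_le_ofReal ?_)
      have h1 := GalerkinRadius.rpow_le_div_log_rpow ha0 hν0.le hA hB hδ hδ1 hN2' hNA hNB
      calc C₁ * δ ^ (a * ν) ≤ C₁ * (Q * ((N : ℝ) / Real.log N) ^ (-ν)) :=
            mul_le_mul_of_nonneg_left h1 hC₁0.le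
        _ = C₁ * Q * ((N : ℝ) / Real.log N) ^ (-ν) := (mul_assoc _ _ _).symm
        _ ≤ _ := mul_le_mul_of_nonneg_right (le_max_right _ _) (by positivity)
    · refine (ENNReal.ofReal_le_ofReal ?_).trans (hlowR N δ (by omega) hδ.le)
      have h1 := GalerkinRadius.rpow_mul_le_of_le_mul hν0.le hN0 hB (mul_pos hT hL) hNB
      rw [Real.mul_rpow hT.le hL.le, GalerkinRadius.rpow_neg_rpow_neg hδ] at h1
      calc min c₁ (c₁ * B ^ (-ν)) * (δ ^ (a * ν) * Real.log (1 / δ) ^ (-ν))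
          ≤ c₁ * B ^ (-ν) * (δ ^ (a * ν) * Real.log (1 / δ) ^ (-ν)) :=
            mul_le_mul_of_nonneg_right (min_le_right _ _) (by positivity)
        _ = c₁ * (B ^ (-ν) * (δ ^ (a * ν) * Real.log (1 / δ) ^ (-ν))) := mul_assoc _ _ _
        _ ≤ c₁ * (N : ℝ) ^ (-ν) := mul_le_mul_of_nonneg_left h1 hc₁.le
    · refine hupper.trans (ENNReal.ofReal_le_ofReal ?_)
      exact mul_le_mul_of_nonneg_right (le_max_left _ _) (by positivity)
  · obtain ⟨C, hC, hC'⟩ := hup hA hB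
    set C₁ : ℝ := B * ((2 + |Real.log B|) / Real.log 2 + a) with hC₁
    refine ⟨max C C₁, lt_max_of_lt_left hC, fun δ hδ hδ1 n hnA hnB => ⟨fun hδ2 => ?_, ?_⟩⟩
    · have hn0 : (0 : ℝ) < n := lt_of_lt_of_le (by positivity) hnA
      have hL : 0 ≤ Real.log (1 / δ) := Real.log_nonneg (by rw [le_div_iff₀ hδ]; linarith)
      exact (GalerkinRadius.card_hypCross_one_le_log hr hB hδ hδ2 (by exact_mod_cast hn0) hnB
        (le_abs_self _) (abs_nonneg _)).trans
        (mul_le_mul_of_nonneg_right (le_max_right _ _) (by positivity))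
    · exact (hC' 1 δ n le_rfl hγ1 hδ hnA hnB).trans (ENNReal.ofReal_le_ofReal
        (mul_le_mul_of_nonneg_right (le_max_left _ _) (by positivity)))
  · obtain ⟨A', B', δ₀, hA', hB', hδ₀, hδ₀2, h⟩ :=
      GalerkinRadius.exists_hypCross_one_card_le hr ha0 hA
    obtain ⟨C, hC, hC'⟩ := hup hA' hB'
    -- Here `N ≥ 2` is not assumed: it follows for small `δ` from `δ^{-a} ≥ 2` and `A log(1/δ) ≥ 1`.
    obtain ⟨δ₁, hδ₁, hδ₁2, hT2⟩ := GalerkinRadius.exists_forall_le_rpow_neg ha0 2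
    obtain ⟨δ₂, hδ₂, hδ₂2, hlog⟩ := GalerkinRadius.exists_forall_le_log (1 / A)
    set Q : ℝ := max (B / a) (B / (A * Real.log 2)) ^ ν with hQ
    refine ⟨A', B', max C (C * Q), min δ₀ (min δ₁ δ₂), hA', hB', lt_max_of_lt_left hC,
      lt_min hδ₀ (lt_min hδ₁ hδ₂), (min_le_left _ _).trans_lt (by linarith),
      fun δ hδ hδ' N hNA hNB => ?_⟩
    have hd0 : δ ≤ δ₀ := hδ'.trans (min_le_left _ _)
    have hd1 : δ ≤ δ₁ := hδ'.trans ((min_le_right _ _).trans (min_le_left _ _))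
    have hd2 : δ ≤ δ₂ := hδ'.trans ((min_le_right _ _).trans (min_le_right _ _))
    have hT := hT2 δ hδ hd1
    have hL := hlog δ hδ hd2
    have hN2 : (2 : ℝ) ≤ N := by
      refine hT.trans (le_trans ?_ hNA)
      rw [mul_left_comm]
      refine le_mul_of_one_le_right (by positivity) ?_
      rwa [div_le_iff₀' hA] at hL
    obtain ⟨n, hn1, hn2, hn3⟩ := h δ hδ hd0 N hNA
    have hn4 := hC' 1 δ n le_rfl hγ1 hδ hn1 hn2
    have hlN : 0 < Real.log N := Real.log_pos (by linarith)
    refine ⟨n, hn1, hn2, hn3, hn4.trans (ENNReal.ofReal_le_ofReal ?_),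
      hn4.trans (ENNReal.ofReal_le_ofReal
        (mul_le_mul_of_nonneg_right (le_max_left _ _) (by positivity)))⟩
    have h1 := GalerkinRadius.rpow_le_div_log_rpow ha0 hν0.le hA hB hδ (by linarith) hN2 hNA hNB
    calc C * δ ^ (a * ν) ≤ C * (Q * ((N : ℝ) / Real.log N) ^ (-ν)) :=
          mul_le_mul_of_nonneg_left h1 hC.le
      _ = C * Q * ((N : ℝ) / Real.log N) ^ (-ν) := (mul_assoc _ _ _).symm
      _ ≤ _ := mul_le_mul_of_nonneg_right (le_max_right _ _) (by positivity)
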